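/- Conventions. Let $n\ge 7$. A homotopy $n$-sphere is a closed smooth $n$-manifold homotopy equivalent to $S^n$; $D^p\subset\mathbb R^p$ is the closed unit ball. *Special generic maps.* A smooth map $f\colon M^n\to\mathbb R^p$ ($n\ge p\ge 1$) is special generic if each of its singular points (points where the differential is not onto) is a definite fold point, i.e. in suitable smooth local coordinates at $x$ and $f(x)$ the map $f$ has the form $(x_1,\dots,x_n)\mapsto(x_1,\dots,x_{p-1},\pm(x_p^2+\dots+x_n^2))$. For $p=1$ it is called a special generic function. *Fold perfection.* For $f\colon M\to\mathbb R^p$ let $W_f$ be the quotient of $M$ (with quotient map $q_f$) that identifies two points if they lie in the same connected component of a fibre of $f$. If $f$ is special generic and $p<n$, then $W_f$ is a smooth $p$-manifold with boundary, with the unique smooth structure for which $q_f$ is smooth, $q_f^{-1}(\partial W_f)$ is the singular set of $f$, and the induced map $W_f\to\mathbb R^p$ is an immersion. A special generic map $f\colon\Sigma^n\to\mathbb R^p$ ($p<n$) is standard if $W_f$ is diffeomorphic to $D^p$. The fold perfection of $\Sigma^n$ is the greatest integer $p\ge1$ for which there is a standard special generic map $\Sigma^n\to\mathbb R^p$. *Morse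 perfection.* The Morse perfection of $\Sigma^n$ is the greatest integer $k\ge-1$ for which there is a smooth map $\eta\colon S^k\times\Sigma^n\to\mathbb R$ such that $\eta_s=\eta(s,\cdot)$ is a special generic function and $\eta_{-s}=-\eta_s$ for all $s\in S^k$ (where $S^{-1}=\emptyset$). *Gromoll filtration.* For a diffeomorphism $g$ of $D^{n-1}$ that is the identity near the boundary, let $\varphi_g$ be the diffeomorphism of $S^{n-1}$ that is given by $g$ on the hemisphere $\{(-\sqrt{1-\|x\|^2},x)\,:\,x\in D^{n-1}\}$ and by the identity on the opposite hemisphere, and let $\Sigma_g$ be the homotopy $n$-sphere obtained by gluing two copies of $D^n$ along their boundaries via $\varphi_g$. The Gromoll filtration of $\Sigma^n$ is the greatest $q\in\{1,\dots,n-1\}$ such that $\Sigma^n$ is diffeomorphic to $\Sigma_g$ for some $g$ that preserves the last $q-1$ coordinates of every point of $D^{n-1}$. **Theorem.** Let $\Sigma^n$ be a homotopy sphere of dimension $n\ge7$. Then 1. $(\text{Gromoll filtration of }\Sigma^n)\le(\text{fold perfection of }\Sigma^n)$, and 2. $(\text{fold perfection of }\Sigma^n)-1\le(\text{Morse perfection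 of }\Sigma^n)$. -/

import Mathlib

open scoped Manifold ContDiff

noncomputable section

namespace FoldPerfection

/-- Euclidean space `ℝ^p`. -/
abbrev E (p : ℕ) : Type := EuclideanSpace ℝ (Fin p)

/-- The standard sphere `S^k ⊂ ℝ^(k+1)`. -/
abbrev S (k : ℕ) : Type := Metric.sphere (0 : E (k + 1)) 1

/-! ### Special generic maps -/

section SpecialGeneric

variable (n : ℕ) {p : ℕ} {M : Type*} [TopologicalSpace M] [ChartedSpace (E n) M]

/-- `x` is a singular point of `f : M^n → ℝ^p`: the differential at `x` is not onto. -/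
def IsSingularPoint (f : M → E p) (x : M) : Prop :=
  ¬ Function.Surjective (mfderiv (𝓡 n) (𝓡 p) f x)

/-- `x` is a fold point of `f : M^n → ℝ^p` with `l` positive squares: in smooth coordinates
`x_1, …, x_n` centred at `x` and `y_1, …, y_p` around `f x` the map `f` is given by
`y_i = x_i` for `i < p` and
`y_p = x_p^2 + … + x_(p+l-1)^2 - x_(p+l)^2 - … - x_n^2`.
(The coordinate `x_(j+1)` is the entry with index `j : Fin n`.) -/
def IsFoldPointWith (l : ℕ) (f : M → E p) (x : M) : Prop :=
  ∃ φ ∈ IsManifold.maximalAtlas (𝓡 n) ∞ M, ∃ ψ ∈ IsManifold.maximalAtlas (𝓡 p) ∞ (E p),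
    x ∈ φ.source ∧ φ x = 0 ∧ Set.MapsTo f φ.source ψ.source ∧
    ∀ z ∈ φ.source,
      (∀ (i : Fin p) (j : Fin n), (i : ℕ) = j → (i : ℕ) + 1 < p → ψ (f z) i = φ z j) ∧
      (∀ i : Fin p, (i : ℕ) + 1 = p → ψ (f z) i =
        ∑ j : Fin n, if (j : ℕ) + 1 < p then 0
          else if (j : ℕ) + 1 < p + l then (φ z j) ^ 2 else -(φ z j) ^ 2)

/-- A definite fold point: a fold point whose absolute index `max (l, n - p + 1 - l)`
equals `n - p + 1`. -/
def IsDefiniteFoldPoint (f : M → E p) (x : M) : Prop :=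
  ∃ l : ℕ, l ≤ n - p + 1 ∧ max l (n - p + 1 - l) = n - p + 1 ∧ IsFoldPointWith n l f x

/-- A special generic map `f : M^n → ℝ^p`, `n ≥ p ≥ 1`. -/
structure IsSpecialGeneric (f : M → E p) : Prop where
  one_le : 1 ≤ p
  le_dim : p ≤ n
  smooth : ContMDiff (𝓡 n) (𝓡 p) ∞ f
  definite : ∀ x, IsSingularPoint n f x → IsDefiniteFoldPoint n f x

/-- A special generic function `M → ℝ`, with `ℝ` regarded as `ℝ^1`. -/
def IsSpecialGenericFunction (h : M → ℝ) : Prop :=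
  IsSpecialGeneric n (fun x => (!₂[h x] : E 1))

end SpecialGeneric

/-! ### Stein factorization -/

section Stein

variable {X Y : Type*} [TopologicalSpace X]

/-- Two points are equivalent if they have the same image `y` and lie in the same connected
component of the fibre over `y`. -/
def steinSetoid (f : X → Y) : Setoid X where
  r x₁ x₂ := f x₁ = f x₂ ∧ x₂ ∈ connectedComponentIn (f ⁻¹' {f x₁}) x₁
  iseqv :=
    { refl := fun _ => ⟨rfl, mem_connectedComponentIn rfl⟩
      symm := fun {x y} h => ⟨h.1.symm, by
        rw [← h.1, ← connectedComponentIn_eq h.2]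
        exact mem_connectedComponentIn rfl⟩
      trans := fun {x y z} h₁ h₂ => ⟨h₁.1.trans h₂.1, by
        rw [connectedComponentIn_eq h₁.2, h₁.1]
        exact h₂.2⟩ }

/-- The space `W_f = X / ∼_f`, with the quotient topology. -/
abbrev SteinSpace (f : X → Y) : Type _ := Quotient (steinSetoid f)

/-- The quotient map `q_f : X → W_f`. -/
def steinQuot (f : X → Y) (x : X) : SteinSpace f := Quotient.mk (steinSetoid f) x

/-- The induced map `W_f → Y`. -/
def steinMap (f : X → Y) : SteinSpace f → Y :=
  Quotient.lift f (fun _ _ h => h.1)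

end Stein

/-! ### Standard special generic maps and fold perfection -/

section Fold

variable (n : ℕ) {p : ℕ} {M : Type*} [TopologicalSpace M] [ChartedSpace (E n) M]

/-- A standard special generic map `f : M^n → ℝ^p`, `p < n`: the Stein factorization `W_f` is
diffeomorphic to the closed unit ball `D^p`.

The smooth structure of `W_f` is the (unique) structure of a smooth `p`-manifold with boundary for
which `q_f` is smooth, the preimage of the boundary under `q_f` is the singular locus, and the
induced map `W_f → ℝ^p` is an immersion. Hence a diffeomorphism `W_f ≅ D^p` is a homeomorphism `ι`
that carries this structure to the one of `D^p`, which is what the three conditions on `ι` say.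
A map on `D^p` is smooth if it is the restriction of a smooth map on `ℝ^p`. -/
def IsStandardSpecialGeneric (f : M → E p) : Prop :=
  IsSpecialGeneric n f ∧ p < n ∧
  ∃ ι : SteinSpace f ≃ₜ Metric.closedBall (0 : E p) 1,
    ContMDiff (𝓡 n) (𝓡 p) ∞ (fun x => (ι (steinQuot f x) : E p)) ∧
    (∀ x, ‖(ι (steinQuot f x) : E p)‖ = 1 ↔ IsSingularPoint n f x) ∧
    ∃ F : E p → E p, ContDiff ℝ ∞ F ∧
      (∀ y ∈ Metric.closedBall (0 : E p) 1, Function.Injective (fderiv ℝ F y)) ∧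
      ∀ w, F (ι w) = steinMap f w

variable (M) in
/-- The greatest `p ≥ 1` for which there is a standard special generic map `M^n → ℝ^p`. The set is
bounded because such maps have `p < n` (and the value is `0` if there is no such map at all). -/
def foldPerfection : ℕ :=
  sSup {p : ℕ | 1 ≤ p ∧ ∃ f : M → E p, IsStandardSpecialGeneric n f}

end Fold

/-! ### Morse perfection -/

section Morse

variable (n : ℕ) (M : Type*) [TopologicalSpace M] [ChartedSpace (E n) M]

/-- There is a smooth odd family of special generic functions on `M` parametrized by `S^k`. -/
def HasMorseFamily (k : ℕ) : Prop :=
  ∃ η : S k × M → ℝ, ContMDiff ((𝓡 k).prod (𝓡 n)) 𝓘(ℝ, ℝ) ∞ η ∧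
    (∀ s, IsSpecialGenericFunction n (fun x => η (s, x))) ∧
    ∀ s x, η (-s, x) = -η (s, x)

/-- The greatest integer `k ≥ -1` for which there is a smooth odd family of special generic
functions on `M` parametrized by `S^k`; as `S^(-1)` is empty, `k = -1` is always admissible.
The supremum is taken in `ℤ ∪ {∞}`. -/
def morsePerfection : WithTop ℤ :=
  sSup {a : WithTop ℤ | a = ((-1 : ℤ) : WithTop ℤ) ∨
    ∃ k : ℕ, HasMorseFamily n M k ∧ a = ((k : ℤ) : WithTop ℤ)}

end Morse

/-! ### Twisted spheres and the Gromoll filtration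

Here `m = n - 1`, so that the homotopy spheres have dimension `n = m + 1`. -/

section Gromoll

/-- The point `(√(1 - t²) z, t)` of `S^(m+1)`, for `z ∈ S^m` and `t ∈ [-1, 1]`. -/
def cyl {m : ℕ} (z : S m) (t : Set.Icc (-1 : ℝ) 1) : S (m + 1) :=
  ⟨WithLp.toLp 2 (Fin.snoc (α := fun _ => ℝ)
      (fun i => √(1 - (t : ℝ) ^ 2) * (z : E (m + 1)) i) (t : ℝ)), by
    have ht : 0 ≤ 1 - (t : ℝ) ^ 2 := by nlinarith [t.2.1, t.2.2]
    have hz : ∑ i, ((z : E (m + 1)) i) ^ 2 = 1 := by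
      rw [← EuclideanSpace.real_norm_sq_eq, mem_sphere_zero_iff_norm.1 z.2, one_pow]
    rw [mem_sphere_zero_iff_norm, ← sq_eq_sq₀ (norm_nonneg _) zero_le_one,
      EuclideanSpace.real_norm_sq_eq, Fin.sum_univ_castSucc]
    simp only [Fin.snoc_castSucc, Fin.snoc_last, mul_pow, Real.sq_sqrt ht, ← Finset.mul_sum, hz]
    ring⟩

/-- The vector `(ε √(1 - ‖x‖²), x)`; for `ε = ±1` and `x ∈ D^m` it lies on `S^m`, and this is the
embedding `ι_± : D^m → S^m` onto a hemisphere. -/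
def hemi {m : ℕ} (ε : ℝ) (x : E m) : E (m + 1) :=
  WithLp.toLp 2 (Fin.cons (α := fun _ => ℝ) (ε * √(1 - ‖x‖ ^ 2)) (fun i => x i))

/-- `g ∈ Diff(D^m, ∂)`: a diffeomorphism of `D^m` that is the identity near the boundary, extended
by the identity to `ℝ^m`. -/
def IsDiscDiffeo {m : ℕ} (g : E m ≃ₘ^∞⟮𝓡 m, 𝓡 m⟯ E m) : Prop :=
  ∃ r < 1, ∀ x, r ≤ ‖x‖ → g x = x

/-- `φ = φ_g`, the diffeomorphism of `S^m` determined by `φ ∘ ι_- = ι_- ∘ g` and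
`φ ∘ ι_+ = ι_+`. -/
def IsSphereExtension {m : ℕ} (g : E m ≃ₘ^∞⟮𝓡 m, 𝓡 m⟯ E m) (φ : S m ≃ₘ^∞⟮𝓡 m, 𝓡 m⟯ S m) : Prop :=
  ∀ x : E m, ‖x‖ ≤ 1 → ∀ z : S m,
    ((z : E (m + 1)) = hemi (-1) x → (φ z : E (m + 1)) = hemi (-1) (g x)) ∧
    ((z : E (m + 1)) = hemi 1 x → φ z = z)

/-- `M` is diffeomorphic to the twisted sphere obtained from two balls of dimension `m + 1` by
identifying their boundaries via the diffeomorphism `φ` of `S^m`. The smooth structure is given by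
gluing the open balls `V_- = S^(m+1) ∖ {(0, …, 0, 1)}` and `V_+ = S^(m+1) ∖ {(0, …, 0, -1)}` along
the open cylinder `S^m × (-1, 1)`, embedded in both by `cyl`, via `φ × id`:
`M` is the union of the images of open smooth embeddings `k_±` of `V_±` that meet exactly in the
image of the cylinder and satisfy `k_- (z, t) = k_+ (φ z, t)`. -/
def IsTwistedSphere {m : ℕ} (φ : S m ≃ₘ^∞⟮𝓡 m, 𝓡 m⟯ S m)
    (M : Type*) [TopologicalSpace M] [ChartedSpace (E (m + 1)) M] : Prop :=
  ∃ kminus kplus : OpenPartialHomeomorph (S (m + 1)) M,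
    kminus.source = {v : S (m + 1) | (v : E (m + 2)) (Fin.last (m + 1)) ≠ 1} ∧
    kplus.source = {v : S (m + 1) | (v : E (m + 2)) (Fin.last (m + 1)) ≠ -1} ∧
    ContMDiffOn (𝓡 (m + 1)) (𝓡 (m + 1)) ∞ kminus kminus.source ∧
    ContMDiffOn (𝓡 (m + 1)) (𝓡 (m + 1)) ∞ kminus.symm kminus.target ∧
    ContMDiffOn (𝓡 (m + 1)) (𝓡 (m + 1)) ∞ kplus kplus.source ∧
    ContMDiffOn (𝓡 (m + 1)) (𝓡 (m + 1)) ∞ kplus.symm kplus.target ∧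
    kminus.target ∪ kplus.target = Set.univ ∧
    kminus.target ∩ kplus.target = kminus '' (kminus.source ∩ kplus.source) ∧
    ∀ (z : S m) (t : Set.Icc (-1 : ℝ) 1), (t : ℝ) ∈ Set.Ioo (-1 : ℝ) 1 →
      kminus (cyl z t) = kplus (cyl (φ z) t)

variable (m : ℕ) (M : Type*) [TopologicalSpace M] [ChartedSpace (E (m + 1)) M]

/-- The class of `M` in `Θ_n`, `n = m + 1`, is of the form `Σ(γ)` with `γ ∈ Γ^n_q`, `q ≥ 1`:
for some `g ∈ Diff(D^(n-1), ∂)` that preserves the last `q - 1` coordinates, `M` is diffeomorphic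
to the twisted sphere of `φ_g`. (`Γ^n_q` consists of the isotopy classes of such `g`, and `Σ` sends
the class of `g` to the class of the twisted sphere. Reversing the orientation of `M` amounts to
replacing `g` by its inverse, so orientations play no role.) -/
def IsInGromollGroup (q : ℕ) : Prop :=
  ∃ (g : E m ≃ₘ^∞⟮𝓡 m, 𝓡 m⟯ E m) (φ : S m ≃ₘ^∞⟮𝓡 m, 𝓡 m⟯ S m),
    IsDiscDiffeo g ∧
    (∀ x : E m, ‖x‖ ≤ 1 → ∀ i : Fin m, m - (q - 1) ≤ (i : ℕ) → g x i = x i) ∧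
    IsSphereExtension g φ ∧ IsTwistedSphere φ M

/-- The Gromoll filtration of `M`, of dimension `n = m + 1`: the greatest `q ∈ {1, …, n - 1}` for
which the class of `M` lies in `Γ^n_q` (so it is `n - 1` for the standard sphere). -/
def gromollFiltration : ℕ :=
  sSup {q : ℕ | 1 ≤ q ∧ q ≤ m ∧ IsInGromollGroup m M q}

end Gromoll

end FoldPerfection

end

open scoped Manifold ContDiff

namespace FoldPerfection

open Set Filter Topology

/-! Fold perfection against Morse perfection. Let f be a standard special generic map to ℝ^p, and
let h : M → D^p be the quotient map followed by W_f ≅ D^p. The height functions η_s = ⟨s, h⟩, s ∈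
S^(p-1), form a smooth odd family; the point is that each is special generic
(`isSpecialGenericFunction_inner`). At a regular point of f the differential of h is onto, so η_s is
not critical. At a singular point x the image of dh is the tangent space of the unit sphere at h(x),
so η_s is critical only for s = ±h(x) (`eq_or_eq_neg_of_critical`). There, with c = ⟨h(x), h⟩ and T
the coordinates orthogonal to h(x), 1 - c = (‖T h‖² + (1 - ‖h‖²)) / (1 + c). Hadamard's lemma writes
1 - ‖h‖² as a positive function K times the sum of squares of the normal fold coordinates. Hence T h
and these coordinates scaled by √K, all divided by √(1 + c), are explicit Morse coordinates
(`exists_morse_coordinates`).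

Gromoll filtration against fold perfection. If g preserves the last q - 1 coordinates, so does φ_g,
and the gluing of the two open balls in S^n preserves the last q coordinates of ℝ^(n+1)
(`lastCoords_cyl_eq`). The projections to these coordinates therefore glue to a map f : M → ℝ^q.
Locally f is the projection of the round sphere, whose singular points lie over the unit sphere;
they are definite folds because 1 - ‖f‖² is the sum of squares of the remaining coordinates. Each
fibre lies in one of the two balls and is a sphere of positive dimension, a point or empty, so it is
connected and f itself identifies W_f with D^q (`isStandardSpecialGeneric_of_spherical_charts`). -/

noncomputable section

/-! ### Integrals with parameters and Hadamard's lemma -/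

section ParametricIntegral

variable {H : Type} [NormedAddCommGroup H] [NormedSpace ℝ H] [FiniteDimensional ℝ H]

/-- The derivative is bounded on the compact set `closedBall x₀ 1 × [0, 1]`, and this constant is
the dominating function. -/
theorem hasFDerivAt_integral_param {F : Type} [NormedAddCommGroup F] [NormedSpace ℝ F]
    {f : H × ℝ → F} (hf : ContDiff ℝ 1 f) (x₀ : H) :
    HasFDerivAt (fun x => ∫ t in (0 : ℝ)..1, f (x, t))
      (∫ t in (0 : ℝ)..1, (fderiv ℝ f (x₀, t)).comp (ContinuousLinearMap.inl ℝ H ℝ)) x₀ := by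
  have hc : Continuous fun z : H × ℝ =>
      (fderiv ℝ f z).comp (ContinuousLinearMap.inl ℝ H ℝ) :=
    (hf.continuous_fderiv (by norm_num)).clm_comp continuous_const
  have : ProperSpace H := FiniteDimensional.proper ℝ H
  obtain ⟨C, hC⟩ := ((isCompact_closedBall x₀ 1).prod (isCompact_Icc (a := (0 : ℝ)) (b := 1)))
    |>.exists_bound_of_continuousOn hc.continuousOn
  refine (intervalIntegral.hasFDerivAt_integral_of_dominated_of_fderiv_le
    (F' := fun x t => (fderiv ℝ f (x, t)).comp (ContinuousLinearMap.inl ℝ H ℝ))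
    (bound := fun _ => C) (Metric.ball_mem_nhds x₀ one_pos) ?_ ?_ ?_ ?_ ?_ ?_)
  · exact Eventually.of_forall fun x =>
      (hf.continuous.comp (by fun_prop : Continuous fun t : ℝ => (x, t))).aestronglyMeasurable
  · exact (hf.continuous.comp
      (by fun_prop : Continuous fun t : ℝ => (x₀, t))).intervalIntegrable _ _
  · exact (hc.comp (by fun_prop : Continuous fun t : ℝ => (x₀, t))).aestronglyMeasurable
  · refine Eventually.of_forall fun t ht x hx => hC (x, t) ⟨Metric.ball_subset_closedBall hx, ?_⟩
    rw [uIoc_of_le zero_le_one] at ht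
    exact ⟨ht.1.le, ht.2⟩
  · exact intervalIntegrable_const
  · refine Eventually.of_forall fun t _ x _ => ?_
    exact ((hf.differentiable (by norm_num)) (x, t)).hasFDerivAt.comp x
      (hasFDerivAt_prodMk_left x t)

/-- Induction on the order. The target varies because the derivative is again such an integral, with
values in `H →L[ℝ] F`. -/
theorem contDiff_integral_param_nat (k : ℕ) : ∀ {F : Type} [NormedAddCommGroup F] [NormedSpace ℝ F]
    {f : H × ℝ → F}, ContDiff ℝ ∞ f → ContDiff ℝ k (fun x => ∫ t in (0 : ℝ)..1, f (x, t)) := by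
  induction k with
  | zero =>
    intro F _ _ f hf
    exact contDiff_zero.2 (continuous_iff_continuousAt.2 fun x =>
      (hasFDerivAt_integral_param (hf.of_le (by norm_cast)) x).continuousAt)
  | succ k ih =>
    intro F _ _ f hf
    push_cast
    refine contDiff_succ_iff_hasFDerivAt.2 ⟨_, ih (f := fun z : H × ℝ =>
      (fderiv ℝ f z).comp (ContinuousLinearMap.inl ℝ H ℝ)) ?_, fun x =>
      hasFDerivAt_integral_param (hf.of_le (by norm_cast)) x⟩
    exact (hf.fderiv_right (m := ∞) (by norm_cast)).clm_comp contDiff_const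

theorem contDiff_integral_param {F : Type} [NormedAddCommGroup F] [NormedSpace ℝ F]
    {f : H × ℝ → F} (hf : ContDiff ℝ ∞ f) :
    ContDiff ℝ ∞ (fun x => ∫ t in (0 : ℝ)..1, f (x, t)) :=
  contDiff_infty.2 fun k => contDiff_integral_param_nat k hf

/-- Hadamard's lemma: the change of a smooth function in the direction `e` is divisible by `ℓ`. -/
theorem exists_eq_add_mul {B : H → ℝ} (hB : ContDiff ℝ ∞ B) (ℓ : H →L[ℝ] ℝ) (e : H) :
    ∃ C : H → ℝ, ContDiff ℝ ∞ C ∧ ∀ w, B w = B (w - ℓ w • e) + ℓ w * C w := by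
  -- The integral of the derivative along the segment from w - ℓ(w)e to w, with the factor ℓ(w) of
  -- the velocity taken out.
  refine ⟨fun w => ∫ t in (0 : ℝ)..1, fderiv ℝ B (w - ℓ w • e + t • ℓ w • e) e, ?_, fun w => ?_⟩
  · refine contDiff_integral_param
      (f := fun z : H × ℝ => fderiv ℝ B (z.1 - ℓ z.1 • e + z.2 • ℓ z.1 • e) e) ?_
    have h1 : ContDiff ℝ ∞ (fderiv ℝ B) := hB.fderiv_right (m := ∞) (by norm_cast)
    have h2 : ContDiff ℝ ∞ fun z : H × ℝ => z.1 - ℓ z.1 • e + z.2 • ℓ z.1 • e := by fun_prop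
    exact (h1.comp h2).clm_apply contDiff_const
  · have hd : ∀ t ∈ uIcc (0 : ℝ) 1, HasDerivAt (fun t : ℝ => B (w - ℓ w • e + t • ℓ w • e))
        (ℓ w * fderiv ℝ B (w - ℓ w • e + t • ℓ w • e) e) t := by
      intro t _
      have h1 : HasDerivAt (fun t : ℝ => w - ℓ w • e + t • ℓ w • e) (ℓ w • e) t := by
        simpa using ((hasDerivAt_id t).smul_const (ℓ w • e)).const_add (w - ℓ w • e)
      have h2 := ((hB.differentiable (by simp)) (w - ℓ w • e + t • ℓ w • e)).hasFDerivAt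
      have h3 := h2.comp_hasDerivAt t h1
      rwa [map_smul, smul_eq_mul] at h3
    have hint := intervalIntegral.integral_eq_sub_of_hasDerivAt hd (by
      apply Continuous.intervalIntegrable
      have h1 : Continuous (fderiv ℝ B) := hB.continuous_fderiv (by simp)
      have h2 : Continuous fun t : ℝ => w - ℓ w • e + t • ℓ w • e := by fun_prop
      exact continuous_const.mul ((h1.comp h2).clm_apply continuous_const))
    rw [intervalIntegral.integral_const_mul] at hint
    rw [hint]
    simp

/-- A cutoff makes the germ of B globally smooth. Since ℓ e = 1, the point w - ℓ(w)e lies in the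
kernel of ℓ, so the constant term of Hadamard's formula vanishes. -/
theorem exists_eventually_eq_mul {B : H → ℝ} (hB : ∀ᶠ w in 𝓝 0, ContDiffAt ℝ ∞ B w)
    (ℓ : H →L[ℝ] ℝ) {e : H} (he : ℓ e = 1) (h0 : ∀ᶠ w in 𝓝 0, ℓ w = 0 → B w = 0) :
    ∃ C : H → ℝ, ContDiff ℝ ∞ C ∧ ∀ᶠ w in 𝓝 0, B w = ℓ w * C w := by
  obtain ⟨ε, hε, hball⟩ := Metric.eventually_nhds_iff_ball.1 hB
  let b : ContDiffBump (0 : H) := ⟨ε / 4, ε / 2, by positivity, by linarith⟩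
  have hsm : ContDiff ℝ ∞ fun w => b w * B w := by
    rw [contDiff_iff_contDiffAt]
    intro w
    by_cases hw : w ∈ Metric.ball 0 ε
    · exact b.contDiffAt.mul (hball w hw)
    · have : w ∉ tsupport b := by
        rw [b.tsupport_eq]
        simp only [Metric.mem_ball, Metric.mem_closedBall, not_lt, not_le] at hw ⊢
        have : b.rOut = ε / 2 := rfl
        linarith
      have h2 : (fun w => b w * B w) =ᶠ[𝓝 w] fun _ => 0 := by
        filter_upwards [notMem_tsupport_iff_eventuallyEq.1 this] with y hy
        simp [hy]
      exact contDiffAt_const.congr_of_eventuallyEq h2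
  obtain ⟨C, hC, hCB⟩ := exists_eq_add_mul hsm ℓ e
  refine ⟨C, hC, ?_⟩
  have ht : Tendsto (fun w => w - ℓ w • e) (𝓝 0) (𝓝 0) := by
    have : Continuous fun w => w - ℓ w • e := by fun_prop
    simpa using this.tendsto 0
  filter_upwards [b.eventuallyEq_one, ht.eventually h0] with w h1 h2
  have := hCB w
  rw [h1, h2 (by simp [he])] at this
  simpa using this

end ParametricIntegral

/-! ### Charts from the inverse function theorem -/

section Charts

/-- The inverse function theorem, with smoothness on the whole source and target. -/
theorem exists_openPartialHomeomorph_of_injective_fderiv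
    {H : Type*} [NormedAddCommGroup H] [NormedSpace ℝ H] [FiniteDimensional ℝ H]
    {g : H → H} {a : H} (hg : ∀ᶠ z in 𝓝 a, ContDiffAt ℝ ∞ g z)
    (hd : Function.Injective (fderiv ℝ g a)) :
    ∃ e : OpenPartialHomeomorph H H, a ∈ e.source ∧ (∀ z, e z = g z) ∧
      ContDiffOn ℝ ∞ e e.source ∧ ContDiffOn ℝ ∞ e.symm e.target := by
  have : CompleteSpace H := FiniteDimensional.complete ℝ H
  let A : H ≃L[ℝ] H :=
    (LinearEquiv.ofInjectiveEndo (fderiv ℝ g a).toLinearMap hd).toContinuousLinearEquiv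
  have hA : (A : H →L[ℝ] H) = fderiv ℝ g a := by ext; rfl
  have hga := hg.self_of_nhds
  have hga' : HasFDerivAt g (A : H →L[ℝ] H) a := by
    rw [hA]; exact (hga.differentiableAt (by simp)).hasFDerivAt
  have hcont : ContinuousAt (fderiv ℝ g) a :=
    (hga.fderiv_right (m := ∞) (by norm_cast)).continuousAt
  -- Invertibility is an open condition; having it on a neighbourhood makes the inverse smooth on
  -- the whole target.
  have hinv : ∀ᶠ z in 𝓝 a, fderiv ℝ g z ∈ range ((↑) : (H ≃L[ℝ] H) → H →L[ℝ] H) :=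
    hcont.eventually (by rw [← hA]; exact ContinuousLinearEquiv.nhds A)
  obtain ⟨U, hU, hUo, haU⟩ := eventually_nhds_iff.1 (hg.and hinv)
  let e₀ := hga.toOpenPartialHomeomorph g hga' (by simp)
  have he₀ : ∀ z, e₀ z = g z := fun z => rfl
  refine ⟨e₀.restrOpen U hUo, ⟨hga.mem_toOpenPartialHomeomorph_source hga' (by simp), haU⟩,
    he₀, fun z hz => ?_, fun y hy => ?_⟩
  · exact (hU z hz.2).1.contDiffWithinAt
  · set e := e₀.restrOpen U hUo
    have hz := e.map_target hy
    obtain ⟨h1, A', hA'⟩ := hU _ hz.2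
    refine (e.contDiffAt_symm (f₀' := A') hy ?_ h1).contDiffWithinAt
    rw [hA']
    exact (h1.differentiableAt (by simp)).hasFDerivAt

variable {n : ℕ} {M : Type*} [TopologicalSpace M] [ChartedSpace (E n) M] [IsManifold (𝓡 n) ∞ M]

/-- A smooth map to `ℝ^n` with injective differential at a point restricts to a chart. -/
theorem exists_chart_of_injective_mfderiv {G : M → E n} {x : M}
    (hG : ∀ᶠ z in 𝓝 x, ContMDiffAt (𝓡 n) (𝓡 n) ∞ G z)
    (hd : Function.Injective (mfderiv (𝓡 n) (𝓡 n) G x)) :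
    ∃ φ ∈ IsManifold.maximalAtlas (𝓡 n) ∞ M, x ∈ φ.source ∧ ∀ z ∈ φ.source, φ z = G z := by
  set c := chartAt (E n) x with hc
  have hcm : c ∈ IsManifold.maximalAtlas (𝓡 n) ∞ M := IsManifold.chart_mem_maximalAtlas x
  have hxc : x ∈ c.source := mem_chart_source _ x
  have hcx : c x ∈ c.target := c.map_source hxc
  have hsymm : ∀ᶠ y in 𝓝 (c x), ContMDiffAt (𝓡 n) (𝓡 n) ∞ c.symm y := by
    filter_upwards [c.open_target.mem_nhds hcx] with y hy
    exact contMDiffAt_symm_of_mem_maximalAtlas hcm hy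
  have ht : Tendsto c.symm (𝓝 (c x)) (𝓝 x) := by
    simpa [c.left_inv hxc] using (c.continuousAt_symm hcx).tendsto
  have hg : ∀ᶠ y in 𝓝 (c x), ContDiffAt ℝ ∞ (G ∘ c.symm) y := by
    filter_upwards [hsymm, ht.eventually hG] with y h1 h2
    exact (h2.comp y h1).contDiffAt
  have hd' : Function.Injective (fderiv ℝ (G ∘ c.symm) (c x)) := by
    rw [← mfderiv_eq_fderiv, mfderiv_comp (I' := 𝓡 n) (c x)
      (by rw [c.left_inv hxc]; exact hG.self_of_nhds.mdifferentiableAt (by simp))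
      (hsymm.self_of_nhds.mdifferentiableAt (by simp))]
    rw [c.left_inv hxc]
    have hmd : c.MDifferentiable (𝓡 n) (𝓡 n) := mdifferentiable_of_mem_atlas (chart_mem_atlas _ x)
    exact hd.comp (hmd.symm.mfderiv_injective hcx)
  obtain ⟨e, hea, heg, hes, het⟩ := exists_openPartialHomeomorph_of_injective_fderiv hg hd'
  refine ⟨c.trans e, ?_, ?_, ?_⟩
  · refine OpenPartialHomeomorph.mem_maximalAtlas_of_contMDiffOn _ ?_ ?_
    · intro z hz
      rw [OpenPartialHomeomorph.trans_source] at hz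
      have h1 := contMDiffAt_of_mem_maximalAtlas hcm hz.1
      have h2 := (hes.contDiffAt (e.open_source.mem_nhds hz.2)).contMDiffAt
      exact (h2.comp z h1).contMDiffWithinAt
    · intro z hz
      rw [OpenPartialHomeomorph.trans_target] at hz
      have h1 := contMDiffAt_symm_of_mem_maximalAtlas hcm hz.2
      have h2 := (het.contDiffAt (e.open_target.mem_nhds hz.1)).contMDiffAt
      exact (h1.comp z h2).contMDiffWithinAt
  · rw [OpenPartialHomeomorph.trans_source]
    exact ⟨hxc, hea⟩
  · intro z hz
    rw [OpenPartialHomeomorph.trans_source] at hz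
    simp [heg, c.left_inv hz.1]

/-- A criterion for fold points: the coordinates are only required to be smooth maps near the point
with injective differential there. -/
theorem isFoldPointWith_of_eventually {p l : ℕ} {f : M → E p} {x : M} (hf : ContinuousAt f x)
    {ψ : E p → E p} {G : M → E n}
    (hψ : ∀ᶠ y in 𝓝 (f x), ContDiffAt ℝ ∞ ψ y) (hψd : Function.Injective (fderiv ℝ ψ (f x)))
    (hG : ∀ᶠ z in 𝓝 x, ContMDiffAt (𝓡 n) (𝓡 n) ∞ G z)
    (hGd : Function.Injective (mfderiv (𝓡 n) (𝓡 n) G x)) (hGx : G x = 0)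
    (h : ∀ᶠ z in 𝓝 x,
      (∀ (i : Fin p) (j : Fin n), (i : ℕ) = j → (i : ℕ) + 1 < p → ψ (f z) i = G z j) ∧
      (∀ i : Fin p, (i : ℕ) + 1 = p → ψ (f z) i =
        ∑ j : Fin n, if (j : ℕ) + 1 < p then 0
          else if (j : ℕ) + 1 < p + l then (G z j) ^ 2 else -(G z j) ^ 2)) :
    IsFoldPointWith n l f x := by
  obtain ⟨φ, hφ, hxφ, hφG⟩ := exists_chart_of_injective_mfderiv hG hGd
  obtain ⟨χ, hχ, hxχ, hχψ⟩ := exists_chart_of_injective_mfderiv (M := E p) (n := p) (x := f x)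
    (hψ.mono fun y hy => hy.contMDiffAt) (by rwa [mfderiv_eq_fderiv])
  -- The chart is shrunk until f maps it into the target chart and the normal form holds throughout.
  obtain ⟨U, hU, hUo, hxU⟩ := eventually_nhds_iff.1
    (h.and (hf.eventually (χ.open_source.mem_nhds hxχ)))
  refine ⟨φ.restr U, restr_mem_maximalAtlas _ hφ hUo, χ, hχ, ?_, ?_, ?_, ?_⟩
  · rw [φ.restr_source' U hUo]; exact ⟨hxφ, hxU⟩
  · simpa [hφG x hxφ] using hGx
  · intro z hz
    rw [φ.restr_source' U hUo] at hz
    exact (hU z hz.2).2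
  · intro z hz
    rw [φ.restr_source' U hUo] at hz
    have := hU z hz.2
    simpa only [OpenPartialHomeomorph.restr_apply, hφG z hz.1, hχψ _ this.2] using this.1

end Charts

/-! ### Linear coordinates and the definite fold model -/

section Coordinates

variable {n r : ℕ}

/-- Coordinates on the orthogonal complement of a unit vector. -/
theorem exists_complement_coordinates {s : E (r + 1)} (hs : ‖s‖ = 1) :
    ∃ T : E (r + 1) →L[ℝ] E r, ∀ y, ‖y‖ ^ 2 = inner ℝ s y ^ 2 + ‖T y‖ ^ 2 := by
  have hs0 : s ≠ 0 := by rintro rfl; simp at hs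
  have := Fact.mk (@finrank_euclideanSpace_fin ℝ _ (r + 1))
  let U := (OrthonormalBasis.fromOrthogonalSpanSingleton (𝕜 := ℝ) r hs0).repr
  refine ⟨(U.toContinuousLinearEquiv : (ℝ ∙ s)ᗮ →L[ℝ] E r).comp
    (Submodule.orthogonalProjectionOnto (ℝ ∙ s)ᗮ), fun y => ?_⟩
  rw [Submodule.norm_sq_eq_add_norm_sq_projection y (ℝ ∙ s)]
  congr 1
  · have : (Submodule.orthogonalProjectionOnto (ℝ ∙ s) y : E (r + 1)) = inner ℝ s y • s :=
      Submodule.starProjection_unit_singleton ℝ hs y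
    change ‖(Submodule.orthogonalProjectionOnto (ℝ ∙ s) y : E (r + 1))‖ ^ 2 = _
    rw [this, norm_smul, hs, mul_one, Real.norm_eq_abs, sq_abs]
  · simp

/-- The vector with first `r` coordinates those of `u` and the other coordinates those of `a`. -/
def joinCoords (n r : ℕ) : E r × E n →L[ℝ] E n :=
  LinearMap.toContinuousLinearMap
    { toFun := fun z => WithLp.toLp 2 fun j => if h : (j : ℕ) < r then z.1 ⟨j, h⟩ else z.2 j
      map_add' := fun z w => by ext j; by_cases h : (j : ℕ) < r <;> simp [h]
      map_smul' := fun c z => by ext j; by_cases h : (j : ℕ) < r <;> simp [h] }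

theorem joinCoords_apply (z : E r × E n) (j : Fin n) :
    joinCoords n r z j = if h : (j : ℕ) < r then z.1 ⟨j, h⟩ else z.2 j := rfl

/-- The sum of the squares of the coordinates after the first `r`. -/
def tailSq (r : ℕ) (y : E n) : ℝ := ∑ j : Fin n, if (j : ℕ) < r then 0 else y j ^ 2

theorem contDiff_tailSq : ContDiff ℝ ∞ (tailSq r : E n → ℝ) := by
  refine ContDiff.sum fun j _ => ?_
  by_cases h : (j : ℕ) < r
  · simp only [h, if_true]; exact contDiff_const
  · simp only [h, if_false]; fun_prop

theorem tailSq_zero : tailSq r (0 : E n) = 0 := by simp [tailSq]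

theorem tailSq_smul (c : ℝ) (y : E n) : tailSq r (c • y) = c ^ 2 * tailSq r y := by
  simp [tailSq, Finset.mul_sum, mul_pow]

theorem tailSq_nonneg (y : E n) : 0 ≤ tailSq r y :=
  Finset.sum_nonneg fun j _ => by split_ifs <;> positivity

/-- A square has zero derivative where its base vanishes. On the fold locus only the linear part of
`foldModel` survives differentiation. -/
theorem hasFDerivAt_tailSq_of_eq_zero {y : E n} (hy : ∀ j : Fin n, r ≤ j → y j = 0) :
    HasFDerivAt (tailSq r : E n → ℝ) (0 : E n →L[ℝ] ℝ) y := by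
  have : (0 : E n →L[ℝ] ℝ) = ∑ _j : Fin n, (0 : E n →L[ℝ] ℝ) := by simp
  rw [this]
  unfold tailSq
  refine HasFDerivAt.fun_sum fun j _ => ?_
  by_cases h : (j : ℕ) < r
  · simp only [h, if_true]; exact hasFDerivAt_const _ _
  · simp only [h, if_false]
    have := ((EuclideanSpace.proj (𝕜 := ℝ) j).hasFDerivAt (x := y)).pow 2
    simpa [hy j (not_lt.1 h)] using this

theorem sum_dite_lt {n r : ℕ} (hr : r ≤ n) (g : Fin r → ℝ) (b : Fin n → ℝ) :
    ∑ j : Fin n, (if h : (j : ℕ) < r then g ⟨j, h⟩ else b j) =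
      ∑ i, g i + ∑ j : Fin n, if (j : ℕ) < r then 0 else b j := by
  obtain ⟨k, rfl⟩ := Nat.exists_eq_add_of_le hr
  simp [Fin.sum_univ_add]

theorem norm_sq_joinCoords (hr : r ≤ n) (z : E r × E n) :
    ‖joinCoords n r z‖ ^ 2 = ‖z.1‖ ^ 2 + tailSq r z.2 := by
  rw [EuclideanSpace.real_norm_sq_eq, EuclideanSpace.real_norm_sq_eq, tailSq,
    ← sum_dite_lt hr (fun i => z.1 i ^ 2)]
  refine Finset.sum_congr rfl fun j _ => ?_
  rw [joinCoords_apply]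
  split_ifs <;> rfl

/-- The first `r` coordinates, followed by `0`. -/
def trunc (n r : ℕ) : E n →L[ℝ] E (r + 1) :=
  LinearMap.toContinuousLinearMap
    { toFun := fun y => WithLp.toLp 2 fun i =>
        if h : (i : ℕ) < r ∧ (i : ℕ) < n then y ⟨i, h.2⟩ else 0
      map_add' := fun z w => by
        ext i; by_cases h : (i : ℕ) < r ∧ (i : ℕ) < n <;> simp [h]
      map_smul' := fun c z => by
        ext i; by_cases h : (i : ℕ) < r ∧ (i : ℕ) < n <;> simp [h] }

theorem trunc_apply (y : E n) (i : Fin (r + 1)) :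
    trunc n r y i = if h : (i : ℕ) < r ∧ (i : ℕ) < n then y ⟨i, h.2⟩ else 0 := rfl

/-- The first `r` coordinates, followed by zeros. -/
def padZero (n r : ℕ) : E (r + 1) →L[ℝ] E n :=
  LinearMap.toContinuousLinearMap
    { toFun := fun w => WithLp.toLp 2 fun j =>
        if h : (j : ℕ) < r then w ⟨j, h.trans r.lt_succ_self⟩ else 0
      map_add' := fun z w => by ext j; by_cases h : (j : ℕ) < r <;> simp [h]
      map_smul' := fun c z => by ext j; by_cases h : (j : ℕ) < r <;> simp [h] }

theorem padZero_apply (w : E (r + 1)) (j : Fin n) :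
    padZero n r w j = if h : (j : ℕ) < r then w ⟨j, h.trans r.lt_succ_self⟩ else 0 := rfl

theorem trunc_padZero (hr : r ≤ n) {w : E (r + 1)} (hw : w (Fin.last r) = 0) :
    trunc n r (padZero n r w) = w := by
  ext i
  rw [trunc_apply]
  split_ifs with h
  · simp [padZero_apply, h.1]
  · have : i = Fin.last r := by ext; simp; omega
    rw [this, hw]

theorem tailSq_padZero (w : E (r + 1)) : tailSq r (padZero n r w) = 0 := by
  refine Finset.sum_eq_zero fun j _ => ?_
  split_ifs with h
  · rfl
  · simp [padZero_apply, h]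

/-- The normal form of a definite fold. -/
def foldModel (n r : ℕ) (σ : ℝ) (y : E n) : E (r + 1) :=
  trunc n r y + (σ * tailSq r y) • EuclideanSpace.single (Fin.last r) (1 : ℝ)

theorem contDiff_foldModel (σ : ℝ) : ContDiff ℝ ∞ (foldModel n r σ) :=
  (trunc n r).contDiff.add ((contDiff_const.mul contDiff_tailSq).smul contDiff_const)

theorem foldModel_zero (σ : ℝ) : foldModel n r σ 0 = 0 := by simp [foldModel, tailSq_zero]

theorem foldModel_apply_last (σ : ℝ) (y : E n) :
    foldModel n r σ y (Fin.last r) = σ * tailSq r y := by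
  simp [foldModel, trunc_apply]

theorem foldModel_apply_of_lt (σ : ℝ) (y : E n) (i : Fin (r + 1)) (h : (i : ℕ) < r)
    (h' : (i : ℕ) < n) : foldModel n r σ y i = y ⟨i, h'⟩ := by
  have : i ≠ Fin.last r := by rintro rfl; simp at h
  simp [foldModel, trunc_apply, h, h', this]

theorem foldModel_padZero (hr : r ≤ n) (σ : ℝ) {w : E (r + 1)} (hw : w (Fin.last r) = 0) :
    foldModel n r σ (padZero n r w) = w := by
  simp [foldModel, trunc_padZero hr hw, tailSq_padZero]

theorem hasFDerivAt_foldModel_of_eq_zero (σ : ℝ) {y : E n} (hy : ∀ j : Fin n, r ≤ j → y j = 0) :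
    HasFDerivAt (foldModel n r σ) (trunc n r) y := by
  have := (trunc n r).hasFDerivAt.add
    (((hasFDerivAt_tailSq_of_eq_zero hy).const_mul σ).smul_const
      (EuclideanSpace.single (Fin.last r) (1 : ℝ)))
  simp only [smul_zero, ContinuousLinearMap.zero_smulRight, add_zero] at this
  exact this

end Coordinates

/-! ### Fold maps into the unit ball, in local coordinates -/

section BallFold

variable {n r : ℕ}

/-- In fold coordinates, a fold map into the unit ball that maps the singular set to the sphere
is `Θ ∘ foldModel`. Here `1 - ‖Θ‖²` is the last coordinate times a function not vanishing at `0`. -/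
theorem exists_defining_factor {Θ : E (r + 1) → E (r + 1)} (hr : r ≤ n) {σ : ℝ}
    (hΘ : ∀ᶠ w in 𝓝 0, ContDiffAt ℝ ∞ Θ w) (hd : Function.Injective (fderiv ℝ Θ 0))
    (hsph : ∀ᶠ y in 𝓝 (0 : E n), (∀ j : Fin n, r ≤ j → y j = 0) → ‖Θ (foldModel n r σ y)‖ = 1) :
    ∃ C : E (r + 1) → ℝ, ContDiff ℝ ∞ C ∧ C 0 ≠ 0 ∧
      (∀ᶠ w in 𝓝 0, 1 - ‖Θ w‖ ^ 2 = w (Fin.last r) * C w) ∧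
      ∀ w, inner ℝ (Θ 0) (fderiv ℝ Θ 0 w) = -(C 0 / 2) * w (Fin.last r) := by
  let ℓ : E (r + 1) →L[ℝ] ℝ := EuclideanSpace.proj (Fin.last r)
  have hℓ : ∀ w, ℓ w = w (Fin.last r) := fun _ => rfl
  have hpad : Tendsto (padZero n r) (𝓝 0) (𝓝 0) := by
    simpa using (padZero n r).continuous.tendsto 0
  -- `padZero` lifts the hyperplane of vanishing last coordinate to the fold locus, so 1 - ‖Θ‖²
  -- vanishes on it.
  obtain ⟨C, hC, hBC⟩ := exists_eventually_eq_mul (B := fun w => 1 - ‖Θ w‖ ^ 2)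
    (hΘ.mono fun w hw => contDiffAt_const.sub (hw.norm_sq ℝ)) ℓ
    (e := EuclideanSpace.single (Fin.last r) 1) (by simp [hℓ]) (by
      filter_upwards [hpad.eventually hsph] with w hw h0
      rw [foldModel_padZero hr σ h0] at hw
      rw [hw fun j hj => by simp [padZero_apply, not_lt.2 hj]]
      norm_num)
  have hder : ∀ w, inner ℝ (Θ 0) (fderiv ℝ Θ 0 w) = -(C 0 / 2) * w (Fin.last r) := by
    intro w
    have h1 : HasFDerivAt Θ (fderiv ℝ Θ 0) 0 :=
      (hΘ.self_of_nhds.differentiableAt (by simp)).hasFDerivAt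
    have h2 := h1.norm_sq.const_sub 1
    have h3 : HasFDerivAt (fun w => ℓ w * C w) _ 0 :=
      ℓ.hasFDerivAt.mul (hC.differentiable (by simp) 0).hasFDerivAt
    have h4 := (h2.congr_of_eventuallyEq (f₁ := fun w => ℓ w * C w)
      (hBC.mono fun w hw => hw.symm)).unique h3
    have h5 := congrArg (fun A => A w) h4
    simp [hℓ] at h5
    linarith
  refine ⟨C, hC, fun h0 => ?_, hBC, hder⟩
  have h1 : ‖Θ 0‖ = 1 := by
    have := hsph.self_of_nhds (by simp)
    rwa [foldModel_zero] at this
  -- If C 0 were 0, the unit vector Θ 0 would be orthogonal to the range of dΘ, which is the whole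
  -- space.
  obtain ⟨w, hw⟩ := (LinearMap.injective_iff_surjective
    (f := (fderiv ℝ Θ 0).toLinearMap)).1 hd (Θ 0)
  have h2 := hder w
  rw [show fderiv ℝ Θ 0 w = Θ 0 from hw, h0, real_inner_self_eq_norm_sq, h1] at h2
  norm_num at h2

/-- The normal direction of the singular image is the only direction whose height function is
critical. -/
theorem eq_or_eq_neg_of_critical {Θ : E (r + 1) → E (r + 1)} (hr : r ≤ n) {σ : ℝ}
    (hΘ : ∀ᶠ w in 𝓝 0, ContDiffAt ℝ ∞ Θ w) (hd : Function.Injective (fderiv ℝ Θ 0))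
    (hsph : ∀ᶠ y in 𝓝 (0 : E n), (∀ j : Fin n, r ≤ j → y j = 0) → ‖Θ (foldModel n r σ y)‖ = 1)
    {s : E (r + 1)} (hs : ‖s‖ = 1)
    (hcrit : ∀ ξ : E n, inner ℝ s (fderiv ℝ (Θ ∘ foldModel n r σ) 0 ξ) = 0) :
    s = Θ 0 ∨ s = -Θ 0 := by
  obtain ⟨C, -, hC0, -, hder⟩ := exists_defining_factor hr hΘ hd hsph
  have h1 : ‖Θ 0‖ = 1 := by
    have := hsph.self_of_nhds (by simp)
    rwa [foldModel_zero] at this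
  have hfd : fderiv ℝ (Θ ∘ foldModel n r σ) 0 = (fderiv ℝ Θ 0).comp (trunc n r) := by
    have h2 : HasFDerivAt Θ (fderiv ℝ Θ 0) (foldModel n r σ 0) := by
      rw [foldModel_zero]
      exact (hΘ.self_of_nhds.differentiableAt (by simp)).hasFDerivAt
    exact (h2.comp 0 (hasFDerivAt_foldModel_of_eq_zero σ (by simp))).fderiv
  set e : E (r + 1) := EuclideanSpace.single (Fin.last r) 1
  set a := inner ℝ s (fderiv ℝ Θ 0 e)
  have hsder : ∀ w, inner ℝ s (fderiv ℝ Θ 0 w) = a * w (Fin.last r) := by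
    intro w
    have h2 := hcrit (padZero n r (w - w (Fin.last r) • e))
    rw [hfd, ContinuousLinearMap.comp_apply, trunc_padZero hr (by simp [e]), map_sub, map_smul,
      inner_sub_right, inner_smul_right] at h2
    linarith
  have hb : -(C 0 / 2) ≠ 0 := by simpa using hC0
  -- Pairing dΘ with s and with Θ 0 gives multiples of the same functional, the last coordinate.
  -- This ratio makes s - c Θ 0 orthogonal to the range of dΘ, hence to itself.
  set c := a / -(C 0 / 2)
  obtain ⟨w, hw⟩ := (LinearMap.injective_iff_surjective
    (f := (fderiv ℝ Θ 0).toLinearMap)).1 hd (s - c • Θ 0)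
  have hw : fderiv ℝ Θ 0 w = s - c • Θ 0 := hw
  have h3 : inner ℝ (s - c • Θ 0) (s - c • Θ 0) = (0 : ℝ) := by
    nth_rw 2 [← hw]
    rw [inner_sub_left, inner_smul_left, hsder, hder]
    simp only [c, conj_trivial]
    field_simp
    ring
  have h4 : s = c • Θ 0 := sub_eq_zero.1 (inner_self_eq_zero.1 h3)
  have h5 : |c| = 1 := by
    have := congrArg norm h4
    rw [norm_smul, hs, h1, mul_one] at this
    exact this.symm
  rcases eq_or_eq_neg_of_abs_eq h5 with h | h
  · left; rw [h4, h, one_smul]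
  · right; rw [h4, h, neg_smul, one_smul]

/-- The height function in the normal direction is a sum of squares in suitable coordinates. -/
theorem exists_morse_coordinates {Θ : E (r + 1) → E (r + 1)} (hr : r < n) {σ : ℝ}
    (hΘ : ∀ᶠ w in 𝓝 0, ContDiffAt ℝ ∞ Θ w) (hd : Function.Injective (fderiv ℝ Θ 0))
    (hσ : σ ≠ 0)
    (hball : ∀ᶠ y in 𝓝 (0 : E n), ‖Θ (foldModel n r σ y)‖ ≤ 1)
    (hsph : ∀ᶠ y in 𝓝 (0 : E n), (∀ j : Fin n, r ≤ j → y j = 0) → ‖Θ (foldModel n r σ y)‖ = 1) :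
    ∃ G : E n → E n, (∀ᶠ y in 𝓝 0, ContDiffAt ℝ ∞ G y) ∧ G 0 = 0 ∧
      Function.Injective (fderiv ℝ G 0) ∧
      ∀ᶠ y in 𝓝 0, 1 - inner ℝ (Θ 0) (Θ (foldModel n r σ y)) = ‖G y‖ ^ 2 := by
  obtain ⟨C, hC, hC0, hBC, hder⟩ := exists_defining_factor hr.le hΘ hd hsph
  set P := foldModel n r σ
  have hP : ContDiff ℝ ∞ P := contDiff_foldModel σ
  have hP0 : P 0 = 0 := foldModel_zero σ
  have h1 : ‖Θ 0‖ = 1 := by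
    have := hsph.self_of_nhds (by simp)
    rwa [hP0] at this
  have hPt : Tendsto P (𝓝 0) (𝓝 0) := by simpa [hP0] using hP.continuous.tendsto 0
  let K : E n → ℝ := fun y => σ * C (P y)
  have hK : ContDiff ℝ ∞ K := contDiff_const.mul (hC.comp hP)
  have hBK : ∀ᶠ y in 𝓝 (0 : E n), 1 - ‖Θ (P y)‖ ^ 2 = tailSq r y * K y := by
    filter_upwards [hPt.eventually hBC] with y hy
    rw [hy, foldModel_apply_last]
    simp only [K]; ring
  have hK0 : 0 < K 0 := by
    have hne : K 0 ≠ 0 := by simp only [K, hP0]; exact mul_ne_zero hσ hC0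
    refine lt_of_le_of_ne ?_ hne.symm
    -- Along this normal direction t² K(tv) = 1 - ‖Θ‖² ≥ 0; letting t → 0 gives K 0 ≥ 0.
    let v : E n := EuclideanSpace.single ⟨r, hr⟩ 1
    have hv : tailSq r v = 1 := by
      rw [tailSq, Finset.sum_eq_single (⟨r, hr⟩ : Fin n)]
      · simp [v]
      · intro j _ hj
        simp [v, hj]
      · simp
    have hvt : Tendsto (fun t : ℝ => t • v) (𝓝[≠] 0) (𝓝 0) := by
      have : Continuous fun t : ℝ => t • v := by fun_prop
      simpa using (this.tendsto 0).mono_left nhdsWithin_le_nhds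
    have hKt : Tendsto (fun t : ℝ => K (t • v)) (𝓝[≠] 0) (𝓝 (K 0)) :=
      (hK.continuous.tendsto 0).comp hvt
    refine ge_of_tendsto hKt ?_
    filter_upwards [hvt.eventually hBK, hvt.eventually hball, self_mem_nhdsWithin] with t h2 h3 h4
    rw [tailSq_smul, hv, mul_one] at h2
    have h5 : 0 ≤ 1 - ‖Θ (P (t • v))‖ ^ 2 := by
      have := norm_nonneg (Θ (P (t • v)))
      nlinarith
    rw [h2] at h5
    exact nonneg_of_mul_nonneg_right h5 (by have : t ≠ 0 := h4; positivity)
  obtain ⟨T, hT⟩ := exists_complement_coordinates h1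
  have hTs : T (Θ 0) = 0 := by
    have := hT (Θ 0)
    rw [real_inner_self_eq_norm_sq, h1] at this
    have h2 : ‖T (Θ 0)‖ ^ 2 = 0 := by linarith
    simpa using h2
  let c : E n → ℝ := fun y => inner ℝ (Θ 0) (Θ (P y))
  have hΘP : ∀ᶠ y in 𝓝 (0 : E n), ContDiffAt ℝ ∞ (fun y => Θ (P y)) y := by
    filter_upwards [hPt.eventually hΘ] with y hy
    exact hy.comp y hP.contDiffAt
  have hc0 : c 0 = 1 := by simp [c, hP0, h1]
  have hcpos : ∀ᶠ y in 𝓝 (0 : E n), 0 < 1 + c y := by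
    have : ContinuousAt (fun y => 1 + c y) 0 :=
      continuousAt_const.add (continuousAt_const.inner hΘP.self_of_nhds.continuousAt)
    exact this.eventually (lt_mem_nhds (by norm_num [hc0]))
  have hKpos : ∀ᶠ y in 𝓝 (0 : E n), 0 < K y :=
    hK.continuous.continuousAt.eventually (lt_mem_nhds hK0)
  -- From ‖Θ‖² = c² + ‖TΘ‖² one gets 1 - c² = ‖TΘ‖² + K · `tailSq` = ‖J‖², and division by 1 + c
  -- leaves 1 - c. `joinCoords` discards the first r coordinates of √K y.
  let J : E n → E n := fun y => joinCoords n r (T (Θ (P y)), √(K y) • y)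
  let G : E n → E n := fun y => (√(1 + c y))⁻¹ • J y
  have hJ0 : J 0 = 0 := by simp only [J, hP0, hTs, smul_zero, Prod.mk_zero_zero, map_zero]
  have hJsm : ∀ᶠ y in 𝓝 0, ContDiffAt ℝ ∞ J y := by
    filter_upwards [hΘP, hKpos] with y h2 h3
    exact (joinCoords n r).contDiff.contDiffAt.comp y
      ((T.contDiff.contDiffAt.comp y h2).prodMk ((hK.contDiffAt.sqrt h3.ne').smul contDiffAt_id))
  have hcsm : ∀ᶠ y in 𝓝 0, ContDiffAt ℝ ∞ (fun y => (√(1 + c y))⁻¹) y := by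
    filter_upwards [hΘP, hcpos] with y h2 h3
    exact ((contDiffAt_const.add (contDiffAt_const.inner ℝ h2)).sqrt h3.ne').inv
      (Real.sqrt_pos.2 h3).ne'
  refine ⟨G, ?_, by simp [G, hJ0], ?_, ?_⟩
  · filter_upwards [hJsm, hcsm] with y h2 h3
    exact h3.smul h2
  · have hDΘ : HasFDerivAt (fun y => Θ (P y)) ((fderiv ℝ Θ 0).comp (trunc n r)) 0 := by
      have h2 : HasFDerivAt Θ (fderiv ℝ Θ 0) (P 0) := by
        rw [hP0]
        exact (hΘ.self_of_nhds.differentiableAt (by simp)).hasFDerivAt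
      exact h2.comp 0 (hasFDerivAt_foldModel_of_eq_zero σ (by simp))
    have hDK : HasFDerivAt (fun y : E n => √(K y) • y)
        (√(K 0) • ContinuousLinearMap.id ℝ (E n)) 0 := by
      have h2 := (((hK.contDiffAt (x := 0)).sqrt hK0.ne').differentiableAt (by simp)).hasFDerivAt
      have h3 := h2.smul (hasFDerivAt_id (0 : E n))
      simp only [id_eq, ContinuousLinearMap.smulRight_zero, add_zero] at h3
      exact h3
    have hDJ := (joinCoords n r).hasFDerivAt.comp (0 : E n)
      ((T.hasFDerivAt.comp (0 : E n) hDΘ).prodMk hDK)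
    have hDG : HasFDerivAt G _ 0 :=
      (hcsm.self_of_nhds.differentiableAt (by simp)).hasFDerivAt.smul hDJ
    rw [hDG.fderiv]
    refine (injective_iff_map_eq_zero _).2 fun ξ hξ => ?_
    rw [hJ0, ContinuousLinearMap.smulRight_zero, add_zero, hc0, smul_apply, smul_eq_zero] at hξ
    have hξ' := hξ.resolve_left (by positivity)
    have h2 := norm_sq_joinCoords hr.le (T (fderiv ℝ Θ 0 (trunc n r ξ)), √(K 0) • ξ)
    have h3 : joinCoords n r (T (fderiv ℝ Θ 0 (trunc n r ξ)), √(K 0) • ξ) = 0 := hξ'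
    have hT0 : T (fderiv ℝ Θ 0 (trunc n r ξ)) = 0 := by
      have h4 := tailSq_nonneg (r := r) (√(K 0) • ξ)
      rw [h3] at h2
      have h5 := sq_nonneg ‖T (fderiv ℝ Θ 0 (trunc n r ξ))‖
      simp only [norm_zero] at h2
      have : ‖T (fderiv ℝ Θ 0 (trunc n r ξ))‖ ^ 2 = 0 := by linarith
      simpa using this
    -- A truncated vector has last coordinate 0, so by `hder` its image under dΘ has no component
    -- along Θ 0 either.
    have h6 : trunc n r ξ = 0 := by
      refine hd ?_
      have h7 := hT (fderiv ℝ Θ 0 (trunc n r ξ))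
      rw [hT0, hder, trunc_apply, dif_neg (by simp)] at h7
      simpa using h7
    ext j
    by_cases hj : (j : ℕ) < r
    · have h8 := congrArg (fun w => w ⟨j, hj.trans r.lt_succ_self⟩) h6
      simpa [trunc_apply, hj] using h8
    · have h8 := congrArg (fun w => w j) h3
      simp only [joinCoords_apply, hj, dite_false, PiLp.smul_apply, smul_eq_mul, PiLp.zero_apply,
        mul_eq_zero] at h8
      exact h8.resolve_left (Real.sqrt_pos.2 hK0).ne'
  · filter_upwards [hBK, hcpos, hKpos] with y h2 h3 h4
    have h5 := norm_sq_joinCoords hr.le (T (Θ (P y)), √(K y) • y)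
    have h6 := hT (Θ (P y))
    simp only [tailSq_smul, Real.sq_sqrt h4.le] at h5
    simp only [G, J]
    rw [norm_smul, mul_pow, h5, norm_inv, inv_pow, Real.norm_eq_abs, sq_abs, Real.sq_sqrt h3.le]
    change 1 - c y = _
    have h7 : ‖Θ (P y)‖ ^ 2 = c y ^ 2 + ‖T (Θ (P y))‖ ^ 2 := h6
    field_simp
    linarith

end BallFold

/-! ### Height functions are special generic -/

section Height

variable {n r : ℕ} {M : Type*} [TopologicalSpace M] [ChartedSpace (E n) M]

theorem mdifferentiable_of_mem_maximalAtlas {n : ℕ} {M : Type*} [TopologicalSpace M]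
    [ChartedSpace (E n) M] [IsManifold (𝓡 n) ∞ M] {φ : OpenPartialHomeomorph M (E n)}
    (hφ : φ ∈ IsManifold.maximalAtlas (𝓡 n) ∞ M) : φ.MDifferentiable (𝓡 n) (𝓡 n) :=
  ⟨(contMDiffOn_of_mem_maximalAtlas hφ).mdifferentiableOn (by simp),
    (contMDiffOn_symm_of_mem_maximalAtlas hφ).mdifferentiableOn (by simp)⟩

/-- A definite fold point in terms of the normal form `foldModel`. -/
theorem IsDefiniteFoldPoint.exists_foldModel {f : M → E (r + 1)} {x : M} (hr : r < n)
    (h : IsDefiniteFoldPoint n f x) :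
    ∃ σ : ℝ, σ ≠ 0 ∧ ∃ φ ∈ IsManifold.maximalAtlas (𝓡 n) ∞ M,
      ∃ ψ ∈ IsManifold.maximalAtlas (𝓡 (r + 1)) ∞ (E (r + 1)),
      x ∈ φ.source ∧ φ x = 0 ∧ MapsTo f φ.source ψ.source ∧
      ∀ z ∈ φ.source, ψ (f z) = foldModel n r σ (φ z) := by
  obtain ⟨l, hl, hmax, φ, hφ, ψ, hψ, hx, hx0, hmaps, hform⟩ := h
  -- The condition on the absolute index leaves only l = 0 (all squares negative) and l = n - r (all
  -- positive).
  refine ⟨if l = 0 then -1 else 1, by split_ifs <;> norm_num, φ, hφ, ψ, hψ, hx, hx0, hmaps,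
    fun z hz => ?_⟩
  obtain ⟨h1, h2⟩ := hform z hz
  ext i
  by_cases hi : (i : ℕ) < r
  · rw [foldModel_apply_of_lt _ _ i hi (hi.trans hr)]
    exact h1 i ⟨i, hi.trans hr⟩ rfl (by omega)
  · obtain rfl : i = Fin.last r := by ext; simp; omega
    rw [foldModel_apply_last, h2 _ (by simp), tailSq, Finset.mul_sum]
    refine Finset.sum_congr rfl fun j _ => ?_
    have hj := j.2
    by_cases hjr : (j : ℕ) < r
    · simp [hjr]
    · by_cases hl0 : l = 0
      · simp [hjr, hl0]
      · have : (j : ℕ) + 1 < r + 1 + l := by omega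
        simp [hjr, hl0, this]

theorem not_surjective_trunc : ¬ Function.Surjective (trunc n r) := by
  intro h
  obtain ⟨y, hy⟩ := h (EuclideanSpace.single (Fin.last r) 1)
  have := congrArg (fun w => w (Fin.last r)) hy
  simp [trunc_apply] at this

variable [IsManifold (𝓡 n) ∞ M]

/-- The points of the hyperplane `x_(r+1) = … = x_n = 0` in fold coordinates are singular. -/
theorem isSingularPoint_of_foldModel {f : M → E (r + 1)} {σ : ℝ}
    {φ : OpenPartialHomeomorph M (E n)} (hφ : φ ∈ IsManifold.maximalAtlas (𝓡 n) ∞ M)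
    {ψ : OpenPartialHomeomorph (E (r + 1)) (E (r + 1))}
    (hψ : ψ ∈ IsManifold.maximalAtlas (𝓡 (r + 1)) ∞ (E (r + 1)))
    (hmaps : MapsTo f φ.source ψ.source)
    (hform : ∀ z ∈ φ.source, ψ (f z) = foldModel n r σ (φ z))
    (hf : ContMDiff (𝓡 n) (𝓡 (r + 1)) ∞ f) {z : M} (hz : z ∈ φ.source)
    (h0 : ∀ j : Fin n, r ≤ j → φ z j = 0) : IsSingularPoint n f z := by
  intro hsurj
  have hφd := mdifferentiable_of_mem_maximalAtlas hφ
  have hψd := mdifferentiable_of_mem_maximalAtlas hψ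
  have hy : φ z ∈ φ.target := φ.map_source hz
  have h1 : HasMFDerivAt (𝓡 n) (𝓡 n) φ.symm (φ z) (mfderiv (𝓡 n) (𝓡 n) φ.symm (φ z)) :=
    (hφd.mdifferentiableAt_symm hy).hasMFDerivAt
  have h2 : HasMFDerivAt (𝓡 n) (𝓡 (r + 1)) f (φ.symm (φ z)) (mfderiv (𝓡 n) (𝓡 (r + 1)) f z) := by
    rw [φ.left_inv hz]
    exact (hf.mdifferentiableAt (by simp)).hasMFDerivAt
  have h3 : HasMFDerivAt (𝓡 (r + 1)) (𝓡 (r + 1)) ψ (f (φ.symm (φ z)))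
      (mfderiv (𝓡 (r + 1)) (𝓡 (r + 1)) ψ (f z)) := by
    rw [φ.left_inv hz]
    exact (hψd.mdifferentiableAt (hmaps hz)).hasMFDerivAt
  have h4 := h3.comp (φ z) (h2.comp (φ z) h1)
  have h5 : HasMFDerivAt (𝓡 n) (𝓡 (r + 1)) (foldModel n r σ) (φ z) (trunc n r) :=
    (hasFDerivAt_foldModel_of_eq_zero σ h0).hasMFDerivAt
  have h6 : (ψ ∘ f ∘ φ.symm) =ᶠ[𝓝 (φ z)] foldModel n r σ := by
    filter_upwards [φ.open_target.mem_nhds hy] with y hy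
    simp [hform _ (φ.map_target hy), φ.right_inv hy]
  have h7 := hasMFDerivAt_unique (h5.congr_of_eventuallyEq h6) h4
  -- Chart differentials are invertible, so surjectivity of df would pass to its coordinate form
  -- `trunc`.
  refine not_surjective_trunc (n := n) (r := r) ?_
  have h8 : Function.Surjective (mfderiv (𝓡 n) (𝓡 n) φ.symm (φ z)) :=
    hφd.symm.mfderiv_surjective hy
  have h9 : Function.Surjective (mfderiv (𝓡 (r + 1)) (𝓡 (r + 1)) ψ (f z)) :=
    hψd.mfderiv_surjective (hmaps hz)
  have h10 := (h9.comp (hsurj.comp h8))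
  intro w
  obtain ⟨ξ, hξ⟩ := h10 w
  exact ⟨ξ, by rw [h7]; exact hξ⟩

/-- `y ↦ ⟨s, y⟩` with values in `ℝ^1`. -/
def innerE {p : ℕ} (s : E p) : E p →L[ℝ] E 1 :=
  LinearMap.toContinuousLinearMap
    { toFun := fun y => !₂[inner ℝ s y]
      map_add' := fun y z => by ext i; fin_cases i; simp [inner_add_right]
      map_smul' := fun c y => by ext i; fin_cases i; simp [inner_smul_right] }

theorem innerE_apply {p : ℕ} (s y : E p) : innerE s y = !₂[inner ℝ s y] := rfl

/-- The height functions of a special generic map onto the unit ball are special generic. -/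
theorem isSpecialGenericFunction_inner {f h : M → E (r + 1)} (hf : IsSpecialGeneric n f)
    (hrn : r + 1 < n) (hh : ContMDiff (𝓡 n) (𝓡 (r + 1)) ∞ h) (hball : ∀ x, ‖h x‖ ≤ 1)
    (hsph : ∀ x, ‖h x‖ = 1 ↔ IsSingularPoint n f x) {F : E (r + 1) → E (r + 1)}
    (hF : ContDiff ℝ ∞ F)
    (hFd : ∀ y ∈ Metric.closedBall (0 : E (r + 1)) 1, Function.Injective (fderiv ℝ F y))
    (hFh : ∀ x, F (h x) = f x) {s : E (r + 1)} (hs : ‖s‖ = 1) :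
    IsSpecialGenericFunction n (fun x => inner ℝ s (h x)) := by
  have hη : (fun x => (!₂[inner ℝ s (h x)] : E 1)) = innerE s ∘ h := rfl
  have hsm : ContMDiff (𝓡 n) (𝓡 1) ∞ (innerE s ∘ h) := (innerE s).contMDiff.comp hh
  have hdh : ∀ x, HasMFDerivAt (𝓡 n) (𝓡 (r + 1)) h x (mfderiv (𝓡 n) (𝓡 (r + 1)) h x) :=
    fun x => (hh.mdifferentiableAt (by simp)).hasMFDerivAt
  unfold IsSpecialGenericFunction
  rw [hη]
  refine ⟨le_rfl, by omega, hsm, fun x hx => ?_⟩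
  have hcrit : ∀ ξ, inner ℝ s (mfderiv (𝓡 n) (𝓡 (r + 1)) h x ξ : E (r + 1)) = 0 := by
    have key : ∀ D : E n →L[ℝ] E (r + 1), HasMFDerivAt (𝓡 n) (𝓡 (r + 1)) h x D →
        ∀ ξ : E n, inner ℝ s (D ξ) = 0 := by
      intro D hD ξ
      by_contra hne
      refine hx fun (w : E 1) => ?_
      have h1 : HasMFDerivAt (𝓡 n) (𝓡 1) (innerE s ∘ h) x ((innerE s).comp D) :=
        (innerE s).hasMFDerivAt.comp x hD
      rw [h1.mfderiv]
      refine ⟨(w 0 / inner ℝ s (D ξ)) • ξ, ?_⟩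
      change innerE s (D ((w 0 / inner ℝ s (D ξ)) • ξ)) = w
      rw [map_smul, map_smul]
      refine PiLp.ext fun i => ?_
      rw [Subsingleton.elim i 0, innerE_apply]
      simp only [PiLp.smul_apply, smul_eq_mul]
      exact div_mul_cancel₀ _ hne
    exact key _ (hdh x)
  -- If df = dF ∘ dh were onto, injectivity of dF would put s in the image of dh, where ⟨s, s⟩ = 1
  -- contradicts criticality.
  have hxs : IsSingularPoint n f x := by
    intro hsurj
    have h1 : HasMFDerivAt (𝓡 n) (𝓡 (r + 1)) (F ∘ h) x
        ((fderiv ℝ F (h x)).comp (mfderiv (𝓡 n) (𝓡 (r + 1)) h x)) :=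
      ((hF.differentiable (by simp)) (h x)).hasFDerivAt.hasMFDerivAt.comp x (hdh x)
    have h2 : F ∘ h = f := funext hFh
    rw [h2] at h1
    rw [h1.mfderiv] at hsurj
    obtain ⟨ξ, hξ⟩ := hsurj (fderiv ℝ F (h x) s)
    have h3 : (mfderiv (𝓡 n) (𝓡 (r + 1)) h x ξ : E (r + 1)) = s :=
      hFd (h x) (by simpa using hball x) hξ
    have h4 := hcrit ξ
    rw [h3, real_inner_self_eq_norm_sq, hs] at h4
    norm_num at h4
  obtain ⟨σ, hσ, φ, hφ, ψ, hψ, hxφ, hφx, hmaps, hform⟩ :=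
    (hf.definite x hxs).exists_foldModel (by omega)
  obtain ⟨e, hea, heF, hes, het⟩ := exists_openPartialHomeomorph_of_injective_fderiv
    (a := h x) (Eventually.of_forall fun z => hF.contDiffAt) (hFd (h x) (by simpa using hball x))
  have hψx : ψ (f x) = 0 := by rw [hform x hxφ, hφx, foldModel_zero]
  have hfxψ : f x ∈ ψ.source := hmaps hxφ
  have h0ψ : (0 : E (r + 1)) ∈ ψ.target := hψx ▸ ψ.map_source hfxψ
  have hψ0 : ψ.symm 0 = f x := by rw [← hψx, ψ.left_inv hfxψ]
  have hfxe : f x ∈ e.target := by rw [← hFh, ← heF]; exact e.map_source hea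
  have h0φ : (0 : E n) ∈ φ.target := hφx ▸ φ.map_source hxφ
  have hφ0 : φ.symm 0 = x := by rw [← hφx, φ.left_inv hxφ]
  have hefx : e.symm (f x) = h x := by rw [← hFh, ← heF, e.left_inv hea]
  -- With e a local restriction of F, this Θ satisfies h ∘ φ⁻¹ = Θ ∘ `foldModel` near 0.
  set Θ : E (r + 1) → E (r + 1) := e.symm ∘ ψ.symm with hΘdef
  have hΘ0 : Θ 0 = h x := by simp [hΘdef, hψ0, hefx]
  have hψe : ∀ᶠ w in 𝓝 (0 : E (r + 1)), w ∈ ψ.target ∧ ψ.symm w ∈ e.target := by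
    have h1 : ∀ᶠ w in 𝓝 (0 : E (r + 1)), w ∈ ψ.target := ψ.open_target.mem_nhds h0ψ
    exact h1.and ((ψ.continuousAt_symm h0ψ).eventually (e.open_target.mem_nhds (by rwa [hψ0])))
  have hΘ : ∀ᶠ w in 𝓝 0, ContDiffAt ℝ ∞ Θ w := by
    filter_upwards [hψe] with w hw
    exact (het.contDiffAt (e.open_target.mem_nhds hw.2)).comp w
      (contMDiffAt_symm_of_mem_maximalAtlas hψ hw.1).contDiffAt
  have hΘd : Function.Injective (fderiv ℝ Θ 0) := by
    have h1 : HasFDerivAt Θ (fderiv ℝ Θ 0) 0 :=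
      (hΘ.self_of_nhds.differentiableAt (by simp)).hasFDerivAt
    have h2 : DifferentiableAt ℝ (ψ ∘ F) (Θ 0) := by
      rw [hΘ0]
      refine DifferentiableAt.comp (h x) ?_ (hF.differentiable (by simp) _)
      rw [hFh]
      exact (contMDiffAt_of_mem_maximalAtlas hψ hfxψ).contDiffAt.differentiableAt (by simp)
    have h3 := h2.hasFDerivAt.comp 0 h1
    have h4 : ((ψ ∘ F) ∘ Θ) =ᶠ[𝓝 0] id := by
      filter_upwards [hψe] with w hw
      simp only [hΘdef, Function.comp_apply, id_eq]
      rw [← heF, e.right_inv hw.2, ψ.right_inv hw.1]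
    have h5 := ((hasFDerivAt_id (𝕜 := ℝ) (0 : E (r + 1))).congr_of_eventuallyEq h4).unique h3
    intro a b hab
    have h6 := congrArg (fderiv ℝ (ψ ∘ F) (Θ 0)) hab
    have h7 : ∀ a, fderiv ℝ (ψ ∘ F) (Θ 0) (fderiv ℝ Θ 0 a) = a := fun a =>
      (congrArg (fun A => A a) h5).symm
    rwa [h7, h7] at h6
  have hhΘ : ∀ᶠ y in 𝓝 (0 : E n), y ∈ φ.target ∧ h (φ.symm y) = Θ (foldModel n r σ y) := by
    have h1 : ContinuousAt (h ∘ φ.symm) 0 :=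
      hh.continuous.continuousAt.comp (φ.continuousAt_symm h0φ)
    have h2 : ∀ᶠ y in 𝓝 (0 : E n), h (φ.symm y) ∈ e.source :=
      h1.eventually (e.open_source.mem_nhds (by simpa [hφ0] using hea))
    filter_upwards [φ.open_target.mem_nhds h0φ, h2] with y hy h2
    refine ⟨hy, ?_⟩
    have h3 := hform _ (φ.map_target hy)
    rw [φ.right_inv hy] at h3
    rw [← h3]
    simp only [hΘdef, Function.comp_apply]
    rw [ψ.left_inv (hmaps (φ.map_target hy)), ← hFh, ← heF, e.left_inv h2]
  have hΘsph : ∀ᶠ y in 𝓝 (0 : E n), (∀ j : Fin n, r ≤ j → y j = 0) →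
      ‖Θ (foldModel n r σ y)‖ = 1 := by
    filter_upwards [hhΘ] with y hy h0
    rw [← hy.2]
    refine (hsph _).2 (isSingularPoint_of_foldModel hφ hψ hmaps hform hf.smooth
      (φ.map_target hy.1) ?_)
    rwa [φ.right_inv hy.1]
  have hs' : s = h x ∨ s = -h x := by
    rw [← hΘ0]
    refine eq_or_eq_neg_of_critical (n := n) (by omega) hΘ hΘd hΘsph hs fun ξ => ?_
    have h1 : HasMFDerivAt (𝓡 n) (𝓡 n) φ.symm 0 (mfderiv (𝓡 n) (𝓡 n) φ.symm 0) :=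
      ((mdifferentiable_of_mem_maximalAtlas hφ).mdifferentiableAt_symm h0φ).hasMFDerivAt
    have h2 : HasMFDerivAt (𝓡 n) (𝓡 (r + 1)) h (φ.symm 0) (mfderiv (𝓡 n) (𝓡 (r + 1)) h x) := by
      rw [hφ0]; exact hdh x
    have h3 := (h2.comp 0 h1).congr_of_eventuallyEq (f₁ := Θ ∘ foldModel n r σ)
      (hhΘ.mono fun y hy => hy.2.symm)
    rw [← mfderiv_eq_fderiv, h3.mfderiv]
    exact hcrit _
  obtain ⟨G, hG, hG0, hGd, hGeq⟩ := exists_morse_coordinates (n := n) (by omega) hΘ hΘd hσ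
    (hhΘ.mono fun y hy => hy.2 ▸ hball _) hΘsph
  obtain ⟨τ, hτ0, hτ⟩ : ∃ τ : ℝ, τ ≠ 0 ∧ ∀ y, τ * inner ℝ s y = inner ℝ (h x) y := by
    rcases hs' with h1 | h1
    · exact ⟨1, one_ne_zero, fun y => by rw [h1, one_mul]⟩
    · exact ⟨-1, by norm_num, fun y => by rw [h1, inner_neg_left]; ring⟩
  have htφ : Tendsto φ (𝓝 x) (𝓝 0) := by
    simpa [hφx] using (φ.continuousAt hxφ).tendsto
  have hφd := mdifferentiable_of_mem_maximalAtlas hφ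
  -- The target coordinate 1 - τy, with τ the sign in s = ±h(x), turns maxima and minima alike into
  -- n positive squares.
  refine ⟨n, by omega, by omega, isFoldPointWith_of_eventually hsm.continuous.continuousAt
    (ψ := fun y => (!₂[1] : E 1) - τ • y) (G := G ∘ φ)
    (Eventually.of_forall fun y => by fun_prop) ?_ ?_ ?_ (by simp [hφx, hG0]) ?_⟩
  · have h1 : ∀ y : E 1, HasFDerivAt (fun y : E 1 => (!₂[1] : E 1) - τ • y)
        (-(τ • ContinuousLinearMap.id ℝ (E 1))) y := fun y =>
      ((hasFDerivAt_id y).const_smul τ).const_sub _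
    rw [(h1 _).fderiv]
    intro a b hab
    have h2 : -(τ • a) = -(τ • b) := hab
    exact smul_right_injective _ hτ0 (neg_injective h2)
  · filter_upwards [htφ.eventually hG, φ.open_source.mem_nhds hxφ] with z h1 h2
    exact h1.contMDiffAt.comp z (contMDiffAt_of_mem_maximalAtlas hφ h2)
  · have h1 : HasMFDerivAt (𝓡 n) (𝓡 n) G (φ x) (fderiv ℝ G 0) := by
      rw [hφx]
      exact (hG.self_of_nhds.differentiableAt (by simp)).hasFDerivAt.hasMFDerivAt
    have h2 := h1.comp x (hφd.mdifferentiableAt hxφ).hasMFDerivAt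
    rw [h2.mfderiv]
    exact hGd.comp (hφd.mfderiv_injective hxφ)
  · filter_upwards [htφ.eventually hGeq, htφ.eventually hhΘ, φ.open_source.mem_nhds hxφ]
      with z h1 h2 h3
    refine ⟨fun i j hij hi => absurd hi (by omega), fun i _ => ?_⟩
    rw [← h2.2, φ.left_inv h3, hΘ0, EuclideanSpace.real_norm_sq_eq, ← hτ] at h1
    have h4 : ∀ j : Fin n, (j : ℕ) + 1 < 1 + n := fun j => by omega
    simp only [h4, if_true, Function.comp_apply]
    simpa [Subsingleton.elim i 0, innerE_apply] using h1

end Height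

/-! ### Fold perfection minus one bounds Morse perfection from below -/

section MorsePerfection

variable {n : ℕ} {M : Type*} [TopologicalSpace M] [ChartedSpace (E n) M] [IsManifold (𝓡 n) ∞ M]

theorem hasMorseFamily_of_isStandardSpecialGeneric {r : ℕ} {f : M → E (r + 1)}
    (hf : IsStandardSpecialGeneric n f) : HasMorseFamily n M r := by
  obtain ⟨hsg, hpn, ι, hι, hsing, F, hF, hFd, hFι⟩ := hf
  have := Fact.mk (@finrank_euclideanSpace_fin ℝ _ (r + 1))
  refine ⟨fun z => inner ℝ (z.1 : E (r + 1)) (ι (steinQuot f z.2) : E (r + 1)), ?_, fun s => ?_,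
    fun s x => by simp⟩
  · have h1 : ContMDiff ((𝓡 r).prod (𝓡 n)) (𝓡 (r + 1)) ∞
        (fun z : S r × M => (z.1 : E (r + 1))) := contMDiff_coe_sphere.comp contMDiff_fst
    have h2 : ContMDiff ((𝓡 r).prod (𝓡 n)) (𝓡 (r + 1)) ∞
        (fun z : S r × M => (ι (steinQuot f z.2) : E (r + 1))) := hι.comp contMDiff_snd
    have h3 : ContDiff ℝ ∞ fun z : E (r + 1) × E (r + 1) => inner ℝ z.1 z.2 := contDiff_inner
    exact h3.contMDiff.comp (h1.prodMk_space h2)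
  · exact isSpecialGenericFunction_inner hsg hpn hι
      (fun x => mem_closedBall_zero_iff.1 (ι (steinQuot f x)).2) hsing hF hFd (fun x => hFι _)
      (mem_sphere_zero_iff_norm.1 s.2)

theorem hasMorseFamily_sub_one_of_isStandardSpecialGeneric {p : ℕ} (hp : 1 ≤ p) {f : M → E p}
    (hf : IsStandardSpecialGeneric n f) : HasMorseFamily n M (p - 1) := by
  obtain ⟨r, rfl⟩ := Nat.exists_eq_add_of_le' hp
  exact hasMorseFamily_of_isStandardSpecialGeneric hf

/-- The supremum defining the fold perfection is attained because p < n, and ℝ^p has unit sphere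
S^(p-1). Without standard maps it takes the default value 0, matched by the admissible value -1. -/
theorem foldPerfection_sub_one_le_morsePerfection :
    (((foldPerfection n M : ℤ) - 1 : ℤ) : WithTop ℤ) ≤ morsePerfection n M := by
  have hlub : IsLUB {a : WithTop ℤ | a = ((-1 : ℤ) : WithTop ℤ) ∨
      ∃ k : ℕ, HasMorseFamily n M k ∧ a = ((k : ℤ) : WithTop ℤ)} (morsePerfection n M) :=
    WithTop.isLUB_sSup' ⟨_, Or.inl rfl⟩
  rcases Set.eq_empty_or_nonempty {p : ℕ | 1 ≤ p ∧ ∃ f : M → E p, IsStandardSpecialGeneric n f}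
    with h | h
  · have h0 : foldPerfection n M = 0 := by rw [foldPerfection, h]; simp
    refine hlub.1 (Or.inl ?_)
    simp [h0]
  · have hmem := Nat.sSup_mem h ⟨n, fun p hp => by
      obtain ⟨-, f, -, hpn, -⟩ := hp; exact hpn.le⟩
    obtain ⟨h1, f, hf⟩ := hmem
    change 1 ≤ foldPerfection n M at h1
    refine hlub.1 (Or.inr ⟨foldPerfection n M - 1,
      hasMorseFamily_sub_one_of_isStandardSpecialGeneric h1 hf, ?_⟩)
    rw [Nat.cast_sub h1]
    rfl

end MorsePerfection

/-! ### Splitting off the last coordinates -/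

section Splitting

variable {N k q : ℕ}

/-- The first `k` coordinates. -/
def headCoords (h : k ≤ N) : E N →L[ℝ] E k :=
  LinearMap.toContinuousLinearMap
    { toFun := fun v => WithLp.toLp 2 fun i => v (Fin.castLE h i)
      map_add' := fun _ _ => rfl
      map_smul' := fun _ _ => rfl }

/-- The last `q` coordinates. -/
def lastCoords (h : q ≤ N) : E N →L[ℝ] E q :=
  LinearMap.toContinuousLinearMap
    { toFun := fun v => WithLp.toLp 2 fun i => v ⟨N - q + i, by omega⟩
      map_add' := fun _ _ => rfl
      map_smul' := fun _ _ => rfl }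

theorem headCoords_apply (h : k ≤ N) (v : E N) (i : Fin k) :
    headCoords h v i = v (Fin.castLE h i) := rfl

theorem lastCoords_apply (h : q ≤ N) (v : E N) (i : Fin q) :
    lastCoords h v i = v ⟨N - q + i, by omega⟩ := rfl

theorem inner_eq_headCoords_add_lastCoords (h : k + q = N) (v w : E N) :
    inner ℝ v w =
      inner ℝ (headCoords (h ▸ Nat.le_add_right k q) v)
        (headCoords (h ▸ Nat.le_add_right k q) w) +
      inner ℝ (lastCoords (h ▸ Nat.le_add_left q k) v)
        (lastCoords (h ▸ Nat.le_add_left q k) w) := by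
  subst h
  simp only [PiLp.inner_apply, Fin.sum_univ_add, headCoords_apply, lastCoords_apply]
  congr 1
  refine Finset.sum_congr rfl fun i _ => ?_
  have : (⟨k + q - q + i, by omega⟩ : Fin (k + q)) = Fin.natAdd k i := by ext; simp
  rw [this]

theorem norm_sq_eq_headCoords_add_lastCoords (h : k + q = N) (v : E N) :
    ‖v‖ ^ 2 = ‖headCoords (h ▸ Nat.le_add_right k q) v‖ ^ 2 +
      ‖lastCoords (h ▸ Nat.le_add_left q k) v‖ ^ 2 := by
  simp only [← real_inner_self_eq_norm_sq]
  exact inner_eq_headCoords_add_lastCoords h v v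

/-- The vector with the given first `k` and last `q` coordinates. -/
def appendCoords (h : k + q = N) : E k × E q →L[ℝ] E N :=
  LinearMap.toContinuousLinearMap
    { toFun := fun z => WithLp.toLp 2 fun i =>
        if hi : (i : ℕ) < k then z.1 ⟨i, hi⟩ else z.2 ⟨i - k, by omega⟩
      map_add' := fun z w => by ext i; by_cases hi : (i : ℕ) < k <;> simp [hi]
      map_smul' := fun c z => by ext i; by_cases hi : (i : ℕ) < k <;> simp [hi] }

theorem appendCoords_apply (h : k + q = N) (z : E k × E q) (i : Fin N) :
    appendCoords h z i = if hi : (i : ℕ) < k then z.1 ⟨i, hi⟩ else z.2 ⟨i - k, by omega⟩ := rfl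

theorem headCoords_appendCoords (h : k + q = N) (z : E k × E q) :
    headCoords (h ▸ Nat.le_add_right k q) (appendCoords h z) = z.1 := by
  ext i
  simp [headCoords_apply, appendCoords_apply]

theorem lastCoords_appendCoords (h : k + q = N) (z : E k × E q) :
    lastCoords (h ▸ Nat.le_add_left q k) (appendCoords h z) = z.2 := by
  subst h
  ext i
  simp [lastCoords_apply, appendCoords_apply]

theorem appendCoords_headCoords_lastCoords (h : k + q = N) (v : E N) :
    appendCoords h (headCoords (h ▸ Nat.le_add_right k q) v,
      lastCoords (h ▸ Nat.le_add_left q k) v) = v := by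
  subst h
  ext i
  rw [appendCoords_apply]
  split_ifs with hi
  · rfl
  · rw [lastCoords_apply]
    refine congrArg (fun l => v l) (Fin.ext ?_)
    simp
    omega

theorem norm_sq_appendCoords (h : k + q = N) (z : E k × E q) :
    ‖appendCoords h z‖ ^ 2 = ‖z.1‖ ^ 2 + ‖z.2‖ ^ 2 := by
  rw [norm_sq_eq_headCoords_add_lastCoords h, headCoords_appendCoords, lastCoords_appendCoords]

theorem tailSq_appendCoords {n r : ℕ} (h : r + k = n) (z : E r × E k) :
    tailSq r (appendCoords h z) = ‖z.2‖ ^ 2 := by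
  subst h
  rw [EuclideanSpace.real_norm_sq_eq]
  simp [tailSq, Fin.sum_univ_add, appendCoords_apply]

/-- The fibres of the projection of the sphere onto the last coordinates are connected. -/
theorem isPreconnected_sphere_fibre (h : k + q = N) (hk : 2 ≤ k) (y : E q) :
    IsPreconnected {v : Metric.sphere (0 : E N) 1 |
      lastCoords (h ▸ Nat.le_add_left q k) (v : E N) = y} := by
  rw [Topology.IsInducing.subtypeVal.isPreconnected_image.symm]
  have hsub : Subtype.val '' {v : Metric.sphere (0 : E N) 1 |
      lastCoords (h ▸ Nat.le_add_left q k) (v : E N) = y} =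
      (fun a => appendCoords h (a, y)) '' {a : E k | ‖a‖ ^ 2 = 1 - ‖y‖ ^ 2} := by
    ext v
    simp only [mem_image, mem_ofPred_eq, Subtype.exists, mem_sphere_zero_iff_norm]
    constructor
    · rintro ⟨w, hw, hwy, rfl⟩
      refine ⟨headCoords (h ▸ Nat.le_add_right k q) w, ?_, ?_⟩
      · have := norm_sq_eq_headCoords_add_lastCoords h w
        rw [hw, hwy] at this
        linarith
      · rw [← hwy]
        exact appendCoords_headCoords_lastCoords h w
    · rintro ⟨a, ha, rfl⟩
      refine ⟨_, ?_, lastCoords_appendCoords h _, rfl⟩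
      have := norm_sq_appendCoords h (a, y)
      simp only [ha] at this
      have h2 : ‖appendCoords h (a, y)‖ ^ 2 = 1 := by linarith
      exact (pow_eq_one_iff_of_nonneg (norm_nonneg _) two_ne_zero).1 h2
  rw [hsub]
  refine IsPreconnected.image ?_ _ (by fun_prop)
  rcases lt_or_ge (1 - ‖y‖ ^ 2) 0 with hy | hy
  · convert isPreconnected_empty
    ext a
    simp only [mem_ofPred_eq, mem_empty_iff_false, iff_false]
    nlinarith [sq_nonneg ‖a‖]
  · have hset : {a : E k | ‖a‖ ^ 2 = 1 - ‖y‖ ^ 2} = Metric.sphere 0 (√(1 - ‖y‖ ^ 2)) := by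
      ext a
      rw [mem_sphere_zero_iff_norm, eq_comm (a := ‖a‖), Real.sqrt_eq_iff_eq_sq hy (norm_nonneg _)]
      exact eq_comm
    rw [hset]
    -- Here 2 ≤ k is needed: a sphere of positive radius in ℝ^1 is two points.
    refine isPreconnected_sphere ?_ _ _
    rw [← Module.finrank_eq_rank, finrank_euclideanSpace_fin]
    exact_mod_cast hk

end Splitting

/-! ### The projection of the round sphere is a definite fold map -/

section SphereFold

variable {n r : ℕ} {M : Type*} [TopologicalSpace M] [ChartedSpace (E n) M]

/-- `j` is near `x` a smooth embedding of codimension zero into the unit sphere of `ℝ^(n+1)`. -/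
structure IsSphereParametrization (j : M → E (n + 1)) (x : M) : Prop where
  smooth : ∀ᶠ z in 𝓝 x, ContMDiffAt (𝓡 n) (𝓡 (n + 1)) ∞ j z
  norm_eq : ∀ z, ‖j z‖ = 1
  exists_deriv : ∃ A : E n →L[ℝ] E (n + 1), HasMFDerivAt (𝓡 n) (𝓡 (n + 1)) j x A ∧
    Function.Injective A ∧ ∀ w, w ∈ range A ↔ inner ℝ (j x) w = 0

/-- The differential of κ⁻¹ is bijective, and that of the inclusion of the sphere is injective with
range the orthogonal complement of the point. -/
theorem isSphereParametrization_of_openPartialHomeomorph {κ : OpenPartialHomeomorph (S n) M}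
    (h₁ : ContMDiffOn (𝓡 n) (𝓡 n) ∞ κ κ.source)
    (h₂ : ContMDiffOn (𝓡 n) (𝓡 n) ∞ κ.symm κ.target) {x : M} (hx : x ∈ κ.target) :
    IsSphereParametrization (fun z => (κ.symm z : E (n + 1))) x := by
  have := Fact.mk (@finrank_euclideanSpace_fin ℝ _ (n + 1))
  have hκ : κ.MDifferentiable (𝓡 n) (𝓡 n) :=
    ⟨h₁.mdifferentiableOn (by simp), h₂.mdifferentiableOn (by simp)⟩
  have hcoe : ContMDiff (𝓡 n) (𝓡 (n + 1)) ∞ ((↑) : S n → E (n + 1)) := contMDiff_coe_sphere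
  refine ⟨?_, fun z => mem_sphere_zero_iff_norm.1 (κ.symm z).2, ?_⟩
  · filter_upwards [κ.open_target.mem_nhds hx] with z hz
    exact hcoe.contMDiffAt.comp z (h₂.contMDiffAt (κ.open_target.mem_nhds hz))
  · have hd := (hcoe.mdifferentiableAt (x := κ.symm x) (by simp)).hasMFDerivAt.comp x
      (hκ.mdifferentiableAt_symm hx).hasMFDerivAt
    refine ⟨_, hd, ?_, fun w => ?_⟩
    · have hinj : Function.Injective
          (mfderiv (𝓡 n) (𝓡 (n + 1)) ((↑) : S n → E (n + 1)) (κ.symm x)) := by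
        convert! injective_mvfderiv_subtypeVal_sphere (n := n) (κ.symm x)
      exact hinj.comp (hκ.symm.mfderiv_injective hx)
    · have h3 : (mfderiv (𝓡 n) (𝓡 (n + 1)) ((↑) : S n → E (n + 1)) (κ.symm x) :
          E n →L[ℝ] E (n + 1)).range = (ℝ ∙ (κ.symm x : E (n + 1)))ᗮ := by
        convert! range_mvfderiv_subtypeVal (n := n) (κ.symm x)
      have h4 : w ∈ (ℝ ∙ (κ.symm x : E (n + 1)))ᗮ ↔ inner ℝ (κ.symm x : E (n + 1)) w = 0 :=
        Submodule.mem_orthogonal_singleton_iff_inner_right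
      rw [← h4, ← h3]
      constructor
      · rintro ⟨ξ, rfl⟩
        exact ⟨_, rfl⟩
      · rintro ⟨ζ, rfl⟩
        obtain ⟨ξ, rfl⟩ := hκ.symm.mfderiv_surjective hx ζ
        exact ⟨ξ, rfl⟩

variable {j : M → E (n + 1)} {x : M} {f : M → E (r + 1)}

/-- The differential is the projection to the last coordinates restricted to the hyperplane
orthogonal to j x. It is onto exactly when the remaining coordinates of j x are not all zero. -/
theorem isSingularPoint_iff_of_sphereParametrization (hr : r < n) (hj : IsSphereParametrization j x)
    (hf : f =ᶠ[𝓝 x] fun z => lastCoords (by omega) (j z)) :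
    IsSingularPoint n f x ↔ ‖f x‖ = 1 := by
  obtain ⟨A, hA, -, hrange⟩ := hj.exists_deriv
  have hfd : HasMFDerivAt (𝓡 n) (𝓡 (r + 1)) f x
      ((lastCoords (N := n + 1) (q := r + 1) (by omega)).comp A) :=
    (((lastCoords (N := n + 1) (q := r + 1) (by omega)).hasMFDerivAt).comp x
      hA).congr_of_eventuallyEq hf
  have hsum : (n - r) + (r + 1) = n + 1 := by omega
  have hfx : f x = lastCoords (by omega) (j x) := hf.self_of_nhds
  have hsplit := norm_sq_eq_headCoords_add_lastCoords hsum (j x)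
  rw [hj.norm_eq, ← hfx] at hsplit
  rw [IsSingularPoint, hfd.mfderiv]
  constructor
  · intro hns
    by_contra hne
    refine hns fun (c : E (r + 1)) => ?_
    set a := headCoords (hsum ▸ Nat.le_add_right _ _) (j x) with ha
    have ha0 : inner ℝ a a ≠ 0 := by
      rw [real_inner_self_eq_norm_sq]
      intro h0
      rw [h0] at hsplit
      exact hne ((pow_eq_one_iff_of_nonneg (norm_nonneg _) two_ne_zero).1 (by linarith))
    -- The head is chosen to make the lift of c orthogonal to j x, hence tangent.
    obtain ⟨ξ, hξ⟩ := (hrange (appendCoords hsum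
      (-(inner ℝ (f x) c / inner ℝ a a) • a, c))).2 (by
        rw [inner_eq_headCoords_add_lastCoords hsum, headCoords_appendCoords,
          lastCoords_appendCoords, ← ha, ← hfx, inner_smul_right]
        field_simp
        ring)
    refine ⟨ξ, ?_⟩
    change lastCoords (by omega) (A ξ) = c
    rw [hξ, lastCoords_appendCoords]
  · intro h1 hs
    obtain ⟨ξ, hξ⟩ := hs (f x)
    have hξ : lastCoords (by omega) (A ξ) = f x := hξ
    have h2 := (hrange (A ξ)).1 ⟨ξ, rfl⟩
    rw [h1] at hsplit
    have h3 : headCoords (hsum ▸ Nat.le_add_right _ _) (j x) = 0 := by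
      have : ‖headCoords (hsum ▸ Nat.le_add_right _ _) (j x)‖ ^ 2 = 0 := by linarith
      simpa using this
    rw [inner_eq_headCoords_add_lastCoords hsum, h3, inner_zero_left, ← hfx, hξ,
      real_inner_self_eq_norm_sq, h1] at h2
    norm_num at h2

/-- With b the last coordinates and a the others, (T b, a) are coordinates on the source and (T b, 1
- ‖b‖²) on the target. The sphere equation 1 - ‖b‖² = ‖a‖² is the fold normal form. -/
theorem isDefiniteFoldPoint_of_sphereParametrization [IsManifold (𝓡 n) ∞ M] (hr : r < n)
    (hj : IsSphereParametrization j x)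
    (hf : f =ᶠ[𝓝 x] fun z => lastCoords (by omega) (j z)) (hx : ‖f x‖ = 1) :
    IsDefiniteFoldPoint n f x := by
  obtain ⟨A, hA, hAinj, hrange⟩ := hj.exists_deriv
  have hsum : (n - r) + (r + 1) = n + 1 := by omega
  have hsum' : r + (n - r) = n := by omega
  have hfx : f x = lastCoords (by omega) (j x) := hf.self_of_nhds
  obtain ⟨T, hT⟩ := exists_complement_coordinates hx
  set last : E (n + 1) →L[ℝ] E (r + 1) := lastCoords (by omega) with hlast
  set head : E (n + 1) →L[ℝ] E (n - r) := headCoords (hsum ▸ Nat.le_add_right _ _) with hhead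
  have hsplit : ∀ v, ‖v‖ ^ 2 = ‖head v‖ ^ 2 + ‖last v‖ ^ 2 :=
    norm_sq_eq_headCoords_add_lastCoords hsum
  have hheadx : head (j x) = 0 := by
    have h1 := hsplit (j x)
    rw [hj.norm_eq, ← hfx, hx] at h1
    have : ‖head (j x)‖ ^ 2 = 0 := by linarith
    simpa using this
  have hTx : T (f x) = 0 := by
    have h1 := hT (f x)
    rw [real_inner_self_eq_norm_sq, hx] at h1
    have : ‖T (f x)‖ ^ 2 = 0 := by linarith
    simpa using this
  let L : E (n + 1) →L[ℝ] E n := (appendCoords hsum').comp ((T.comp last).prod head)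
  have hL : ∀ v, L v = appendCoords hsum' (T (last v), head v) := fun _ => rfl
  let ψ : E (r + 1) → E (r + 1) := fun b =>
    trunc r r (T b) + (1 - ‖b‖ ^ 2) • EuclideanSpace.single (Fin.last r) (1 : ℝ)
  have hψ : ContDiff ℝ ∞ ψ :=
    ((trunc r r).contDiff.comp T.contDiff).add
      ((contDiff_const.sub (contDiff_norm_sq ℝ)).smul contDiff_const)
  have hψlast : ∀ b, ψ b (Fin.last r) = 1 - ‖b‖ ^ 2 := fun b => by simp [ψ, trunc_apply]
  have hψlt : ∀ b (i : Fin (r + 1)) (h : (i : ℕ) < r), ψ b i = T b ⟨i, h⟩ := fun b i h => by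
    have : i ≠ Fin.last r := by rintro rfl; simp at h
    simp [ψ, trunc_apply, h, this]
  have hcont : ContinuousAt f x :=
    (last.continuous.continuousAt.comp hA.continuousAt).congr_of_eventuallyEq hf
  refine ⟨n - r, by omega, by omega, isFoldPointWith_of_eventually hcont (ψ := ψ)
    (G := fun z => L (j z)) (Eventually.of_forall fun y => hψ.contDiffAt) ?_ ?_ ?_ ?_ ?_⟩
  · have h1 : HasFDerivAt ψ ((trunc r r).comp T + (-(2 • innerSL ℝ (f x))).smulRight
        (EuclideanSpace.single (Fin.last r) (1 : ℝ))) (f x) := by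
      have h2 := (hasStrictFDerivAt_norm_sq (F := E (r + 1)) (f x)).hasFDerivAt.const_sub 1
      exact ((trunc r r).comp T).hasFDerivAt.add (h2.smul_const _)
    rw [h1.fderiv]
    refine (injective_iff_map_eq_zero _).2 fun w hw => ?_
    have h3 : inner ℝ (f x) w = 0 := by
      have := congrArg (fun u => u (Fin.last r)) hw
      simpa [trunc_apply] using this
    have h4 : T w = 0 := by
      ext i
      have := congrArg (fun u => u i.castSucc) hw
      simpa [trunc_apply, Fin.castSucc_ne_last] using this
    have h5 := hT w
    rw [h3, h4] at h5
    simpa using h5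
  · filter_upwards [hj.smooth] with z hz
    exact L.contMDiff.contMDiffAt.comp z hz
  · have h1 : HasMFDerivAt (𝓡 n) (𝓡 n) (fun z => L (j z)) x (L.comp A) :=
      L.hasMFDerivAt.comp x hA
    rw [h1.mfderiv]
    have h2 : Function.Injective (L.comp A) := by
      refine (injective_iff_map_eq_zero _).2 fun ξ hξ => hAinj ?_
      have hξ : appendCoords hsum' (T (last (A ξ)), head (A ξ)) = 0 := hξ
      have h3 : T (last (A ξ)) = 0 := by
        have := headCoords_appendCoords hsum' (T (last (A ξ)), head (A ξ))
        rw [hξ, map_zero] at this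
        exact this.symm
      have h4 : head (A ξ) = 0 := by
        have := lastCoords_appendCoords hsum' (T (last (A ξ)), head (A ξ))
        rw [hξ, map_zero] at this
        exact this.symm
      have h5 := (hrange (A ξ)).1 ⟨ξ, rfl⟩
      rw [inner_eq_headCoords_add_lastCoords hsum, ← hhead, ← hlast, h4, inner_zero_right,
        ← hfx, zero_add] at h5
      have h6 := hsplit (A ξ)
      rw [hT (last (A ξ)), h3, h4, h5] at h6
      simpa using h6
    exact h2
  · rw [hL, hheadx, ← hfx, hTx, Prod.mk_zero_zero, map_zero]
  · filter_upwards [hf] with z hz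
    rw [hz]
    refine ⟨fun i l hil hi => ?_, fun i hi => ?_⟩
    · rw [hψlt _ i (by omega), hL, appendCoords_apply, dif_pos (by omega)]
      exact congrArg (fun i => T (last (j z)) i) (Fin.ext hil)
    · obtain rfl : i = Fin.last r := by ext; simp; omega
      have h1 := hsplit (j z)
      rw [hj.norm_eq] at h1
      have h2 := tailSq_appendCoords hsum' (T (last (j z)), head (j z))
      rw [hψlast, show 1 - ‖last (j z)‖ ^ 2 = ‖head (j z)‖ ^ 2 by linarith, ← h2, tailSq]
      refine Finset.sum_congr rfl fun i _ => ?_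
      have hi := i.2
      by_cases hir : (i : ℕ) < r
      · simp [hir]
      · have : (i : ℕ) + 1 < r + 1 + (n - r) := by omega
        simp only [hir, this, Nat.add_lt_add_iff_right, if_false, if_true]
        rfl

end SphereFold

/-! ### Coordinates preserved by the gluing -/

section TwistedSphere

variable {m r : ℕ}

/-- The extension of `g` to the sphere preserves the coordinates that `g` preserves. -/
theorem sphereExtension_apply_succ {g : E m ≃ₘ^∞⟮𝓡 m, 𝓡 m⟯ E m} {φ : S m ≃ₘ^∞⟮𝓡 m, 𝓡 m⟯ S m}
    (hφ : IsSphereExtension g φ) {i : Fin m} (hg : ∀ x : E m, ‖x‖ ≤ 1 → g x i = x i) (z : S m) :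
    (φ z : E (m + 1)) i.succ = (z : E (m + 1)) i.succ := by
  let x : E m := WithLp.toLp 2 fun i => (z : E (m + 1)) i.succ
  have hz : ‖x‖ ^ 2 = 1 - (z : E (m + 1)) 0 ^ 2 := by
    have h1 : ∑ i, ((z : E (m + 1)) i) ^ 2 = 1 := by
      rw [← EuclideanSpace.real_norm_sq_eq, mem_sphere_zero_iff_norm.1 z.2, one_pow]
    rw [Fin.sum_univ_succ] at h1
    rw [EuclideanSpace.real_norm_sq_eq]
    simp only [x]
    linarith
  have hx : ‖x‖ ≤ 1 := by
    rw [← sq_le_one_iff₀ (norm_nonneg _), hz]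
    nlinarith [sq_nonneg ((z : E (m + 1)) 0)]
  have hsqrt : √(1 - ‖x‖ ^ 2) = |(z : E (m + 1)) 0| := by
    rw [hz, sub_sub_cancel, Real.sqrt_sq_eq_abs]
  -- The first coordinate of z is ±√(1 - ‖x‖²), so its sign decides which hemisphere formula
  -- applies.
  have hhemi : ∀ ε : ℝ, ε * |(z : E (m + 1)) 0| = (z : E (m + 1)) 0 →
      (z : E (m + 1)) = hemi ε x := by
    intro ε hε
    ext l
    refine Fin.cases ?_ (fun l => ?_) l
    · simp [hemi, hsqrt, hε]
    · simp [hemi, x]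
  rcases le_total ((z : E (m + 1)) 0) 0 with h0 | h0
  · rw [(hφ x hx z).1 (hhemi (-1) (by rw [abs_of_nonpos h0]; ring))]
    simp [hemi, hg x hx, x]
  · rw [(hφ x hx z).2 (hhemi 1 (by rw [abs_of_nonneg h0]; ring))]

theorem cyl_apply_last (z : S m) (t : Icc (-1 : ℝ) 1) :
    (cyl z t : E (m + 2)) (Fin.last (m + 1)) = t := by
  simp [cyl]

theorem cyl_apply_castSucc (z : S m) (t : Icc (-1 : ℝ) 1) (i : Fin (m + 1)) :
    (cyl z t : E (m + 2)) i.castSucc = √(1 - (t : ℝ) ^ 2) * (z : E (m + 1)) i := by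
  simp [cyl]

/-- Away from the poles 1 - t² > 0, so the first m + 1 coordinates can be rescaled to a unit vector.
-/
theorem exists_eq_cyl {v : S (m + 1)} (h₁ : (v : E (m + 2)) (Fin.last (m + 1)) ≠ 1)
    (h₂ : (v : E (m + 2)) (Fin.last (m + 1)) ≠ -1) :
    ∃ (z : S m) (t : Icc (-1 : ℝ) 1), (t : ℝ) ∈ Ioo (-1 : ℝ) 1 ∧ v = cyl z t := by
  set t := (v : E (m + 2)) (Fin.last (m + 1)) with ht
  have hv : ∑ i : Fin (m + 1), ((v : E (m + 2)) i.castSucc) ^ 2 + t ^ 2 = 1 := by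
    rw [ht, ← Fin.sum_univ_castSucc (fun i => ((v : E (m + 2)) i) ^ 2),
      ← EuclideanSpace.real_norm_sq_eq, mem_sphere_zero_iff_norm.1 v.2, one_pow]
  have hle : t ^ 2 ≤ 1 := by
    have : 0 ≤ ∑ i : Fin (m + 1), ((v : E (m + 2)) i.castSucc) ^ 2 :=
      Finset.sum_nonneg fun i _ => sq_nonneg _
    linarith
  have hne : t ^ 2 ≠ 1 := fun h => (sq_eq_one_iff.1 h).elim h₁ h₂
  have hlt : 0 < 1 - t ^ 2 := sub_pos.2 (lt_of_le_of_ne hle hne)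
  have habs : |t| < 1 := (sq_lt_one_iff_abs_lt_one t).1 (by linarith)
  have hIoo : t ∈ Ioo (-1 : ℝ) 1 := abs_lt.1 habs
  have hs : 0 < √(1 - t ^ 2) := Real.sqrt_pos.2 hlt
  let z : E (m + 1) := WithLp.toLp 2 fun i => (v : E (m + 2)) i.castSucc / √(1 - t ^ 2)
  have hz : ‖z‖ = 1 := by
    rw [← pow_eq_one_iff_of_nonneg (norm_nonneg _) two_ne_zero, EuclideanSpace.real_norm_sq_eq]
    simp only [z, div_pow, ← Finset.sum_div, Real.sq_sqrt hlt.le]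
    rw [div_eq_one_iff_eq hlt.ne']
    linarith
  refine ⟨⟨z, mem_sphere_zero_iff_norm.2 hz⟩, ⟨t, Ioo_subset_Icc_self hIoo⟩, hIoo, ?_⟩
  ext i
  refine Fin.lastCases ?_ (fun i => ?_) i
  · rw [cyl_apply_last]
  · rw [cyl_apply_castSucc]
    simp only [z]
    field_simp

/-- Of these r + 1 coordinates the last is t and the others are √(1 - t²) times coordinates fixed by
φ. The shift `succ` arises because `hemi` puts the extra coordinate first. -/
theorem lastCoords_cyl_eq {φ : S m → S m} (hr : r ≤ m)
    (hφ : ∀ (i : Fin m), m - r ≤ i → ∀ z, (φ z : E (m + 1)) i.succ = (z : E (m + 1)) i.succ)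
    (z : S m) (t : Icc (-1 : ℝ) 1) :
    lastCoords (N := m + 2) (q := r + 1) (by omega) (cyl (φ z) t) =
      lastCoords (N := m + 2) (q := r + 1) (by omega) (cyl z t) := by
  ext i
  rw [lastCoords_apply, lastCoords_apply]
  by_cases hi : (i : ℕ) < r
  · have : (⟨m + 2 - (r + 1) + i, by omega⟩ : Fin (m + 2)) =
        Fin.castSucc (Fin.succ (⟨m - r + i, by omega⟩ : Fin m)) := by
      ext; simp; omega
    rw [this, cyl_apply_castSucc, cyl_apply_castSucc, hφ _ (by simp)]
  · have : (⟨m + 2 - (r + 1) + i, by omega⟩ : Fin (m + 2)) = Fin.last (m + 1) := by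
      ext; simp; omega
    rw [this, cyl_apply_last, cyl_apply_last]

theorem lastCoords_apply_last (hr : r ≤ m) (v : E (m + 2)) :
    lastCoords (N := m + 2) (q := r + 1) (by omega) v (Fin.last r) = v (Fin.last (m + 1)) := by
  rw [lastCoords_apply]
  refine congrArg (fun l => v l) (Fin.ext ?_)
  simp
  omega

end TwistedSphere

/-! ### Stein factorization of a map with connected fibres -/

section Stein

variable {X : Type*} [TopologicalSpace X] [CompactSpace X] {p : ℕ}

/-- A map with connected fibres identifies its Stein factorization with its image. -/
theorem exists_homeomorph_steinSpace {f : X → E p} (hf : Continuous f)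
    (hrange : range f = Metric.closedBall 0 1) (hfib : ∀ y, IsPreconnected (f ⁻¹' {y})) :
    ∃ ι : SteinSpace f ≃ₜ Metric.closedBall (0 : E p) 1, ∀ w, (ι w : E p) = steinMap f w := by
  have hmem : ∀ w : SteinSpace f, steinMap f w ∈ Metric.closedBall (0 : E p) 1 := by
    intro w
    induction w using Quotient.inductionOn with
    | h x => rw [← hrange]; exact ⟨x, rfl⟩
  have hbij : Function.Bijective fun w : SteinSpace f =>
      (⟨steinMap f w, hmem w⟩ : Metric.closedBall (0 : E p) 1) := by
    constructor
    · intro w₁ w₂ h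
      induction w₁ using Quotient.inductionOn with
      | h x₁ =>
        induction w₂ using Quotient.inductionOn with
        | h x₂ =>
          have h' : f x₁ = f x₂ := congrArg Subtype.val h
          exact Quotient.sound ⟨h', (hfib (f x₁)).subset_connectedComponentIn rfl
            subset_rfl h'.symm⟩
    · rintro ⟨y, hy⟩
      rw [← hrange] at hy
      obtain ⟨x, rfl⟩ := hy
      exact ⟨steinQuot f x, rfl⟩
  have hcont : Continuous fun w : SteinSpace f =>
      (⟨steinMap f w, hmem w⟩ : Metric.closedBall (0 : E p) 1) :=
    (hf.quotient_lift _).subtype_mk _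
  exact ⟨Continuous.homeoOfEquivCompactToT2 (f := Equiv.ofBijective _ hbij) hcont, fun w => rfl⟩

end Stein

/-! ### Gromoll filtration bounds fold perfection from below -/

section Gromoll

variable {m r : ℕ} {M : Type*} [TopologicalSpace M] [CompactSpace M]
  [ChartedSpace (E (m + 1)) M] [IsManifold (𝓡 (m + 1)) ∞ M]

/-- A map which is given by the last coordinates in spherical charts containing its fibres is
standard special generic. -/
theorem isStandardSpecialGeneric_of_spherical_charts (hr : r < m) {f : M → E (r + 1)}
    {K : Set (OpenPartialHomeomorph (S (m + 1)) M)}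
    (hK : ∀ κ ∈ K, ContMDiffOn (𝓡 (m + 1)) (𝓡 (m + 1)) ∞ κ κ.source ∧
      ContMDiffOn (𝓡 (m + 1)) (𝓡 (m + 1)) ∞ κ.symm κ.target ∧
      ∀ v ∈ κ.source, f (κ v) = lastCoords (N := m + 2) (by omega) (v : E (m + 2)))
    (hcov : ∀ x, ∃ κ ∈ K, x ∈ κ.target)
    (hfib : ∀ y, ∃ κ ∈ K, f ⁻¹' {y} ⊆ κ.target ∧
      ∀ v : S (m + 1), lastCoords (N := m + 2) (by omega) (v : E (m + 2)) = y → v ∈ κ.source) :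
    IsStandardSpecialGeneric (m + 1) f := by
  have hsum : (m + 1 - r) + (r + 1) = m + 2 := by omega
  have hpar : ∀ x, ∃ j : M → E (m + 2), IsSphereParametrization (n := m + 1) j x ∧
      f =ᶠ[𝓝 x] fun z => lastCoords (N := m + 2) (by omega) (j z) := by
    intro x
    obtain ⟨κ, hκK, hx⟩ := hcov x
    obtain ⟨h1, h2, h3⟩ := hK κ hκK
    refine ⟨_, isSphereParametrization_of_openPartialHomeomorph h1 h2 hx, ?_⟩
    filter_upwards [κ.open_target.mem_nhds hx] with z hz
    rw [← h3 _ (κ.map_target hz), κ.right_inv hz]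
  have hsing : ∀ x, IsSingularPoint (m + 1) f x ↔ ‖f x‖ = 1 := fun x => by
    obtain ⟨j, hj, hfj⟩ := hpar x
    exact isSingularPoint_iff_of_sphereParametrization (by omega) hj hfj
  have hsm : ContMDiff (𝓡 (m + 1)) (𝓡 (r + 1)) ∞ f := fun x => by
    obtain ⟨j, hj, hfj⟩ := hpar x
    exact ((lastCoords (N := m + 2) (q := r + 1) (by omega)).contMDiff.contMDiffAt.comp x
      hj.smooth.self_of_nhds).congr_of_eventuallyEq hfj
  have hsg : IsSpecialGeneric (m + 1) f := ⟨by omega, by omega, hsm, fun x hx => by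
    obtain ⟨j, hj, hfj⟩ := hpar x
    exact isDefiniteFoldPoint_of_sphereParametrization (by omega) hj hfj ((hsing x).1 hx)⟩
  have hrange : range f = Metric.closedBall 0 1 := by
    ext y
    rw [mem_closedBall_zero_iff]
    constructor
    · rintro ⟨x, rfl⟩
      obtain ⟨j, hj, hfj⟩ := hpar x
      have h1 := norm_sq_eq_headCoords_add_lastCoords hsum (j x)
      have h2 : f x = lastCoords (N := m + 2) (by omega) (j x) := hfj.self_of_nhds
      rw [hj.norm_eq, ← h2] at h1
      rw [← sq_le_one_iff₀ (norm_nonneg _)]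
      nlinarith [sq_nonneg ‖headCoords (hsum ▸ Nat.le_add_right _ _) (j x)‖]
    · intro hy
      have hy' : 0 ≤ 1 - ‖y‖ ^ 2 := by
        have := (sq_le_one_iff₀ (norm_nonneg y)).2 hy
        linarith
      -- A point of the sphere over y, with the missing length placed on one axis.
      let a : E (m + 1 - r) := EuclideanSpace.single ⟨0, by omega⟩ (√(1 - ‖y‖ ^ 2))
      have ha : ‖a‖ ^ 2 = 1 - ‖y‖ ^ 2 := by simp [a, Real.sq_sqrt hy']
      have hv : ‖appendCoords hsum (a, y)‖ = 1 := by
        rw [← pow_eq_one_iff_of_nonneg (norm_nonneg _) two_ne_zero, norm_sq_appendCoords]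
        linarith
      obtain ⟨κ, hκK, -, hκ⟩ := hfib y
      let v : S (m + 1) := ⟨appendCoords hsum (a, y), mem_sphere_zero_iff_norm.2 hv⟩
      have hvy : lastCoords (N := m + 2) (by omega) (v : E (m + 2)) = y :=
        lastCoords_appendCoords hsum (a, y)
      exact ⟨κ v, by rw [(hK κ hκK).2.2 v (hκ v hvy), hvy]⟩
  have hconn : ∀ y, IsPreconnected (f ⁻¹' {y}) := by
    intro y
    obtain ⟨κ, hκK, hsub, hκ⟩ := hfib y
    have h3 := (hK κ hκK).2.2
    have himage : f ⁻¹' {y} = κ '' {v : S (m + 1) |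
        lastCoords (N := m + 2) (by omega) (v : E (m + 2)) = y} := by
      ext x
      constructor
      · intro hx
        have hxt := hsub hx
        refine ⟨κ.symm x, ?_, κ.right_inv hxt⟩
        change lastCoords (N := m + 2) (by omega) (κ.symm x : E (m + 2)) = y
        rw [← h3 _ (κ.map_target hxt), κ.right_inv hxt]
        exact hx
      · rintro ⟨v, hv, rfl⟩
        exact (h3 v (hκ v hv)).trans hv
    rw [himage]
    exact (isPreconnected_sphere_fibre hsum (by omega) y).image _
      (κ.continuousOn.mono fun v hv => hκ v hv)
  obtain ⟨ι, hι⟩ := exists_homeomorph_steinSpace hsm.continuous hrange hconn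
  have hιf : ∀ x, (ι (steinQuot f x) : E (r + 1)) = f x := fun x => hι _
  -- Since ι is induced by f itself, the immersion F of the ball is the identity.
  refine ⟨hsg, by omega, ι, ?_, fun x => ?_, id, contDiff_id, fun y _ => ?_, hι⟩
  · simpa only [hιf] using hsm
  · rw [hιf, hsing]
  · rw [fderiv_id]
    exact Function.injective_id

theorem exists_isStandardSpecialGeneric_of_isInGromollGroup (hr : r < m)
    (h : IsInGromollGroup m M (r + 1)) :
    ∃ f : M → E (r + 1), IsStandardSpecialGeneric (m + 1) f := by
  classical
  obtain ⟨g, φ, -, hg, hφ, k₁, k₂, hs₁, hs₂, h₁, h₁', h₂, h₂', hunion, hinter, hglue⟩ := h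
  have hφi : ∀ (i : Fin m), m - r ≤ i → ∀ z, (φ z : E (m + 1)) i.succ = (z : E (m + 1)) i.succ :=
    fun i hi => sphereExtension_apply_succ hφ fun x hx => hg x hx i hi
  let L : E (m + 2) →L[ℝ] E (r + 1) := lastCoords (by omega)
  have hLlast : ∀ v : S (m + 1), L v (Fin.last r) = (v : E (m + 2)) (Fin.last (m + 1)) :=
    fun v => lastCoords_apply_last hr.le v
  have hL : ∀ z t, L (cyl (φ z) t) = L (cyl z t) := lastCoords_cyl_eq hr.le hφi
  have hcyl₁ : ∀ (z : S m) (t : Icc (-1 : ℝ) 1), (t : ℝ) ∈ Ioo (-1 : ℝ) 1 →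
      cyl z t ∈ k₁.source := fun z t ht => by
    rw [hs₁]
    exact fun h => ht.2.ne ((cyl_apply_last z t).symm.trans h)
  have hcyl₂ : ∀ (z : S m) (t : Icc (-1 : ℝ) 1), (t : ℝ) ∈ Ioo (-1 : ℝ) 1 →
      cyl z t ∈ k₂.source := fun z t ht => by
    rw [hs₂]
    exact fun h => ht.1.ne' ((cyl_apply_last z t).symm.trans h)
  have hne₁ : ∀ v ∈ k₁.source, (v : E (m + 2)) (Fin.last (m + 1)) ≠ 1 := fun v hv => by
    rw [hs₁] at hv; exact hv
  have hne₂ : ∀ v ∈ k₂.source, (v : E (m + 2)) (Fin.last (m + 1)) ≠ -1 := fun v hv => by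
    rw [hs₂] at hv; exact hv
  let f : M → E (r + 1) := fun x => if x ∈ k₁.target then L (k₁.symm x) else L (k₂.symm x)
  have hf₁ : ∀ v ∈ k₁.source, f (k₁ v) = L v := fun v hv => by
    simp [f, k₁.map_source hv, k₁.left_inv hv]
  have hf₂ : ∀ v ∈ k₂.source, f (k₂ v) = L v := fun v hv => by
    by_cases hx : k₂ v ∈ k₁.target
    · have hmem : k₂ v ∈ k₁.target ∩ k₂.target := ⟨hx, k₂.map_source hv⟩
      rw [hinter] at hmem
      obtain ⟨w, ⟨hw₁, hw₂⟩, hwv⟩ := hmem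
      obtain ⟨z, t, ht, rfl⟩ := exists_eq_cyl (hne₁ w hw₁) (hne₂ w hw₂)
      have hv' : cyl (φ z) t = v :=
        k₂.injOn (hcyl₂ _ t ht) hv ((hglue z t ht).symm.trans hwv)
      rw [← hwv, hf₁ _ hw₁, ← hv', hL]
    · simp [f, hx, k₂.left_inv hv]
  have hcov : ∀ x, x ∈ k₁.target ∨ x ∈ k₂.target := fun x => by
    rw [← mem_union, hunion]; exact mem_univ x
  refine ⟨f, isStandardSpecialGeneric_of_spherical_charts hr (K := {k₁, k₂}) ?_ ?_ fun y => ?_⟩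
  · rintro κ (rfl | rfl)
    · exact ⟨h₁, h₁', hf₁⟩
    · exact ⟨h₂, h₂', hf₂⟩
  · intro x
    rcases hcov x with hx | hx
    · exact ⟨k₁, Or.inl rfl, hx⟩
    · exact ⟨k₂, Or.inr rfl, hx⟩
  · by_cases hy : y (Fin.last r) = 1
    · refine ⟨k₂, Or.inr rfl, fun x hx => ?_, fun v hv => ?_⟩
      · refine (hcov x).resolve_left fun hx₁ => hne₁ _ (k₁.map_target hx₁) ?_
        rw [← hLlast, ← hf₁ _ (k₁.map_target hx₁), k₁.right_inv hx₁]
        exact (congrArg (fun w => w (Fin.last r)) hx).trans hy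
      · rw [hs₂]
        intro h
        have h' := hLlast v
        rw [show L v = y from hv, hy, h] at h'
        norm_num at h'
    · refine ⟨k₁, Or.inl rfl, fun x hx => ?_, fun v hv => ?_⟩
      · rcases hcov x with hx₁ | hx₂
        · exact hx₁
        have hv := k₂.map_target hx₂
        have hLv : L (k₂.symm x) = y := by
          rw [← hf₂ _ hv, k₂.right_inv hx₂]
          exact hx
        obtain ⟨z, t, ht, hzt⟩ := exists_eq_cyl (v := k₂.symm x)
          (by rw [← hLlast, hLv]; exact hy) (hne₂ _ hv)
        have h1 := hglue (φ.symm z) t ht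
        rw [φ.apply_symm_apply, ← hzt, k₂.right_inv hx₂] at h1
        rw [← h1]
        exact k₁.map_source (hcyl₁ _ t ht)
      · rw [hs₁]
        intro h
        refine hy ?_
        rw [← show L v = y from hv, hLlast]
        exact h

theorem gromollFiltration_le_foldPerfection : gromollFiltration m M ≤ foldPerfection (m + 1) M := by
  rcases Set.eq_empty_or_nonempty {q : ℕ | 1 ≤ q ∧ q ≤ m ∧ IsInGromollGroup m M q} with h | h
  · rw [gromollFiltration, h]
    simp
  · obtain ⟨h1, hm, hq⟩ := Nat.sSup_mem h ⟨m, fun q hq => hq.2.1⟩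
    change 1 ≤ gromollFiltration m M at h1
    change gromollFiltration m M ≤ m at hm
    change IsInGromollGroup m M (gromollFiltration m M) at hq
    obtain ⟨r, hr⟩ := Nat.exists_eq_add_of_le' h1
    rw [hr] at hm hq ⊢
    refine le_csSup ⟨m + 1, fun p hp => ?_⟩
      ⟨by omega, exists_isStandardSpecialGeneric_of_isInGromollGroup (by omega) hq⟩
    obtain ⟨-, f, -, hpn, -⟩ := hp
    exact hpn.le

end Gromoll

end

end FoldPerfection

theorem mainTheorem1 (m : ℕ) (hm : 7 ≤ m + 1)
    (M : Type*) [TopologicalSpace M] [T2Space M] [CompactSpace M]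
    [ChartedSpace (EuclideanSpace ℝ (Fin (m + 1))) M] [IsManifold (𝓡 (m + 1)) ∞ M]
    (hM : Nonempty (ContinuousMap.HomotopyEquiv M
      (Metric.sphere (0 : EuclideanSpace ℝ (Fin (m + 1 + 1))) 1))) :
    FoldPerfection.gromollFiltration m M ≤ FoldPerfection.foldPerfection (m + 1) M ∧
    (((FoldPerfection.foldPerfection (m + 1) M : ℤ) - 1 : ℤ) : WithTop ℤ) ≤
      FoldPerfection.morsePerfection (m + 1) M := by
  exact ⟨FoldPerfection.gromollFiltration_le_foldPerfection,
    FoldPerfection.foldPerfection_sub_one_le_morsePerfection⟩
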